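/- Equip $SO(3)$ with the Riemannian metric $\langle RA,RB\rangle=\tfrac12\operatorname{tr}(A^TB)$ ($A,B$ skew-symmetric), so that its geodesic distance is $d(R,Q)=\arccos\frac{\operatorname{tr}(R^TQ)-1}{2}$. Let $\varepsilon>0$, let $0<r<\frac{\pi}{4}-\varepsilon$, and put $\mathcal D_\varepsilon=\{R\in SO(3): d(I,R)<\frac{\pi}{2}-\varepsilon\}$ and $\overline D_r=\{R\in SO(3): d(I,R)\le r\}$. Let $K(R,Q)=g(d(R,Q)^2)$, where $g:[0,\infty)\to\mathbb R$ is differentiable with locally Lipschitz derivative $g'$, and let $h(s)=\frac{s}{\sin s}\,g'(s^2)$ for $s>0$, $h(0)=g'(0)$. For a curve $\rho=(\rho_t)_{t\ge0}$ of Borel probability measures on $\mathcal D_\varepsilon$ put $v[\rho](R,t)=-\int_{\mathcal D_\varepsilon}\nabla K_Q(R)\,d\rho_t(Q)$, where $K_Q(R)=K(R,Q)$ and $\nabla$ is the Riemannian gradient on $SO(3)$. The curve $\rho$ is a global weak solution of $\partial_t\rho+\nabla\cdot(\rho v)=0$, $v=-\nabla K*\rho$, in $\mathcal D_\varepsilon$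 if there is a unique map $\Psi:\operatorname{supp}(\rho_0)\times[0,\infty)\to\mathcal D_\varepsilon$ with $\frac{d}{dt}\Psi^t(R)=v[\rho](\Psi^t(R),t)$ and $\Psi^0(R)=R$ for all $R\in\operatorname{supp}(\rho_0)$ and $t\ge0$, and $\rho_t=\Psi^t\#\rho_0$ for all $t\ge0$. Assume that (i) $g'\ge0$ on $[0,\infty)$ and $g'$ is continuously differentiable on $[0,4r^2]$; (ii) for every $a>0$ there is $b\in(0,a)$ with $h(b)>0$, and $h$ is non-decreasing on $[0,2r]$; (iii) $\rho_0$ is a Borel probability measure on $\mathcal D_\varepsilon$ with $\operatorname{supp}(\rho_0)\subset\overline D_r$. Let $\rho$ be a narrowly continuous curve $[0,\infty)\to\mathcal P(\mathcal D_\varepsilon)$ that is a global weak solution starting from $\rho_0$. Then there exists $P\in\overline D_r$ such that $W_1(\rho_t,\delta_P)\to0$ as $t\to\infty$, where $W_1(\mu,\nu)=\inf_\pi\int d(R,Q)\,d\pi(R,Q)$, the infimum being over all transport plans $\pi$ between $\mu$ and $\nu$. -/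

import Mathlib

open MeasureTheory Filter Topology Set

noncomputable section

namespace SO3Aggregation

/-- The rotation group `SO(3)`, with the topology inherited from `ℝ^{3×3}`. -/
abbrev SO3 : Type := ↥(Matrix.specialOrthogonalGroup (Fin 3) ℝ)

instance : MeasurableSpace SO3 := borel SO3

instance : BorelSpace SO3 := ⟨rfl⟩

/-- The skew-symmetric matrix `v̂` of a vector `v ∈ ℝ³`. -/
def hat (v : Fin 3 → ℝ) : Matrix (Fin 3) (Fin 3) ℝ :=
  !![0, -v 2, v 1; v 2, 0, -v 0; -v 1, v 0, 0]

theorem hat_transpose (v : Fin 3 → ℝ) : (hat v).transpose = -hat v := by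
  ext i j
  fin_cases i <;> fin_cases j <;> simp [hat]

theorem hat_smul (c : ℝ) (v : Fin 3 → ℝ) : hat (c • v) = c • hat v := by
  ext i j
  fin_cases i <;> fin_cases j <;> simp [hat]

theorem exp_hat_mul_transpose (v : Fin 3 → ℝ) :
    NormedSpace.exp (hat v) * (NormedSpace.exp (hat v)).transpose = 1 := by
  have hc : Commute (hat v) (-hat v) := (Commute.refl (hat v)).neg_right
  rw [← Matrix.exp_transpose, hat_transpose, ← Matrix.exp_add_of_commute _ _ hc, add_neg_cancel,
    NormedSpace.exp_zero]

/-- The exponential of a skew-symmetric `3 × 3` matrix is a rotation. -/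
theorem exp_hat_mem (v : Fin 3 → ℝ) :
    NormedSpace.exp (hat v) ∈ Matrix.specialOrthogonalGroup (Fin 3) ℝ := by
  rw [Matrix.mem_specialOrthogonalGroup_iff, Matrix.mem_orthogonalGroup_iff]
  refine ⟨exp_hat_mul_transpose v, ?_⟩
  have h2 : NormedSpace.exp (hat v) =
      NormedSpace.exp (hat ((2⁻¹ : ℝ) • v)) * NormedSpace.exp (hat ((2⁻¹ : ℝ) • v)) := by
    rw [← Matrix.exp_add_of_commute _ _ (Commute.refl _), hat_smul, ← add_smul]
    norm_num
  have h3 := congrArg Matrix.det (exp_hat_mul_transpose ((2⁻¹ : ℝ) • v))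
  rw [Matrix.det_mul, Matrix.det_transpose, Matrix.det_one] at h3
  rw [h2, Matrix.det_mul, h3]

/-- The matrix exponential `exp v̂`, as an element of `SO(3)`. -/
def expHat (v : Fin 3 → ℝ) : SO3 := ⟨NormedSpace.exp (hat v), exp_hat_mem v⟩

/-- The geodesic distance `d(R, Q) = arccos ((tr (Rᵀ Q) - 1) / 2)`, the angle of the rotation
`Rᵀ Q`. It is the Riemannian distance of the metric `⟨R A, R B⟩ = (1/2) tr (Aᵀ B)`. -/
def geodDist (R Q : SO3) : ℝ :=
  Real.arccos ((Matrix.trace ((R : Matrix (Fin 3) (Fin 3) ℝ).transpose *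
    (Q : Matrix (Fin 3) (Fin 3) ℝ)) - 1) / 2)

/-- The open geodesic disk of radius `r` centred at the identity. -/
def disk (r : ℝ) : Set SO3 := {Q | geodDist 1 Q < r}

/-- The closed geodesic disk of radius `r` centred at the identity. -/
def closedDisk (r : ℝ) : Set SO3 := {Q | geodDist 1 Q ≤ r}

/-- The Riemannian gradient at `R` of a function on `SO(3)`, for the metric
`⟨R A, R B⟩ = (1/2) tr (Aᵀ B)`, as a matrix in `T_R SO(3) = {R A | A skew-symmetric}`.
The vectors `R ê₁, R ê₂, R ê₃` form an orthonormal basis of `T_R SO(3)`, and the derivative of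
`f` in the direction `R ê_i` is taken along the geodesic `t ↦ R exp (t ê_i)`. -/
def grad (f : SO3 → ℝ) (R : SO3) : Matrix (Fin 3) (Fin 3) ℝ :=
  (R : Matrix (Fin 3) (Fin 3) ℝ) *
    hat (fun i => deriv (fun t : ℝ => f (R * expHat (t • Pi.single i (1 : ℝ)))) 0)

/-- The derivative of `g : [0, ∞) → ℝ` (one-sided at `0`). Only the values of `g` on `[0, ∞)`
matter. -/
def dg (g : ℝ → ℝ) (s : ℝ) : ℝ := derivWithin g (Ici 0) s

/-- The interaction potential `K(R, Q) = g(d(R, Q)²)`. -/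
def potential (g : ℝ → ℝ) (R Q : SO3) : ℝ := g (geodDist R Q ^ 2)

/-- The function `h(s) = s g'(s²) / sin s`, with `h(0) = g'(0)`. -/
def hFun (g : ℝ → ℝ) (s : ℝ) : ℝ :=
  if s = 0 then dg g 0 else s / Real.sin s * dg g (s ^ 2)

/-- The velocity `-(∇K * μ)(R) = -∫ ∇K_Q(R) dμ(Q)`, where `K_Q(R) = K(R, Q)`; the integral of the
matrix-valued integrand is taken entry by entry. -/
def velocity (g : ℝ → ℝ) {U : Set SO3} (μ : Measure U) (R : SO3) : Matrix (Fin 3) (Fin 3) ℝ :=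
  Matrix.of fun i j => -∫ Q : U, grad (fun S => potential g S Q) R i j ∂μ

/-- `Ψ` is a global flow map on `S ⊆ U` of the time-dependent vector field `X` on `U`:
`d/dt Ψᵗ(R) = X_t(Ψᵗ(R))` for `t ≥ 0` (one-sided at `t = 0`, derivative in `ℝ^{3×3}`, entry by
entry) and `Ψ⁰(R) = R`, for all `R ∈ S`. Values of `Ψ` outside `S` or at negative times are
irrelevant. -/
def IsGlobalFlowMap {U : Set SO3} (X : ℝ → SO3 → Matrix (Fin 3) (Fin 3) ℝ) (S : Set U)
    (Ψ : ℝ → U → U) : Prop :=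
  ∀ R ∈ S, Ψ 0 R = R ∧ ∀ t : ℝ, 0 ≤ t → ∀ i j : Fin 3,
    HasDerivWithinAt (fun s : ℝ => ((Ψ s R : SO3) : Matrix (Fin 3) (Fin 3) ℝ) i j)
      (X t (Ψ t R : SO3) i j) (Ici 0) t

/-- A global weak solution in `U` of the aggregation equation
`∂ₜρ + ∇·(ρ v) = 0`, `v = -∇K * ρ`: the velocity field generates a unique flow map on
`supp ρ₀ × [0, ∞)` and `ρ_t` is the push-forward of `ρ₀` by this flow map. -/
def IsGlobalWeakSolution (g : ℝ → ℝ) {U : Set SO3} (ρ : ℝ → ProbabilityMeasure U) : Prop :=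
  ∃ Ψ : ℝ → U → U,
    IsGlobalFlowMap (fun t => velocity g (ρ t : Measure U)) (ρ 0 : Measure U).support Ψ ∧
    (∀ Φ : ℝ → U → U,
      IsGlobalFlowMap (fun t => velocity g (ρ t : Measure U)) (ρ 0 : Measure U).support Φ →
      ∀ R ∈ (ρ 0 : Measure U).support, ∀ t : ℝ, 0 ≤ t → Φ t R = Ψ t R) ∧
    ∀ t : ℝ, 0 ≤ t → (ρ t : Measure U) = Measure.map (Ψ t) (ρ 0 : Measure U)

/-- The intrinsic `1`-Wasserstein distance: the infimum of `∫ d(R, Q) dπ(R, Q)` over all transport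
plans `π` between `μ` and `ν`. -/
def W1 {U : Set SO3} (μ ν : Measure U) : ENNReal :=
  ⨅ (π : Measure (U × U)) (_ : π.map Prod.fst = μ ∧ π.map Prod.snd = ν),
    ∫⁻ p, ENNReal.ofReal (geodDist (p.1 : SO3) (p.2 : SO3)) ∂π

end SO3Aggregation

end

noncomputable section

/-! Rotations of angle at most π/2 lift to unit quaternions with positive real part and pairwise
non-negative inner products, and those products are `halfCos`, the cosines of half the distances. A
geometric claim thus becomes algebra in ℝ⁴.

Off the cut locus, `grad_potential` gives the gradient of `K_Q` as `-h(d) • toward R Q`. Hence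
`cosSq A` grows along a trajectory at the average over Q of `pull`, which equals 4 h z u (w - z u),
where z, u, w are `halfCos` of (R,Q), (A,R), (A,Q). If u and w are at least k, `pull_ge` bounds this
below by -4H(u² - k²) plus a non-negative gain. A Grönwall argument on the infimum over all
particles (`lower_bound_persists`) then shows that a disk containing every particle keeps them.

For pairs of particles the gain is uniformly positive while their distance is not small: one of the
two is far from Q, and monotonicity of h bounds the interaction below. So the diameter of the
support tends to 0 (`eventually_one_sub_le_cosSq`). A limit point P of one trajectory stays inside
all the shrinking disks, which bounds W₁ to δ_P. -/

namespace SO3Aggregation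

/-! ### Quaternion lifts of rotations -/

/-- The rotation matrix `v ↦ q v q̄` of a quaternion `q = (q₀, q₁, q₂, q₃)`. -/
def rotMatrix (q : Fin 4 → ℝ) : Matrix (Fin 3) (Fin 3) ℝ :=
  !![q 0 ^ 2 + q 1 ^ 2 - q 2 ^ 2 - q 3 ^ 2, 2 * (q 1 * q 2 - q 0 * q 3), 2 * (q 1 * q 3 + q 0 * q 2);
    2 * (q 1 * q 2 + q 0 * q 3), q 0 ^ 2 - q 1 ^ 2 + q 2 ^ 2 - q 3 ^ 2, 2 * (q 2 * q 3 - q 0 * q 1);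
    2 * (q 1 * q 3 - q 0 * q 2), 2 * (q 2 * q 3 + q 0 * q 1), q 0 ^ 2 - q 1 ^ 2 - q 2 ^ 2 + q 3 ^ 2]

theorem trace_rotMatrix_transpose_mul (a b : Fin 4 → ℝ) :
    ((rotMatrix a).transpose * rotMatrix b).trace =
      4 * (a ⬝ᵥ b) ^ 2 - (a ⬝ᵥ a) * (b ⬝ᵥ b) := by
  simp [rotMatrix, Matrix.trace, Matrix.mul_apply, Fin.sum_univ_three, dotProduct,
    Fin.sum_univ_four]
  ring

/-- The quaternion x ȳ x is 2(x·y)x - |x|²y, so Q ↦ R Qᵀ R is the geodesic reflection through R. -/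
theorem rotMatrix_mul_transpose_mul (x y : Fin 4 → ℝ) :
    rotMatrix x * (rotMatrix y).transpose * rotMatrix x =
      rotMatrix ((2 * (x ⬝ᵥ y)) • x - (x ⬝ᵥ x) • y) := by
  ext i j
  simp only [Matrix.mul_apply, Fin.sum_univ_three, Matrix.transpose_apply, dotProduct,
    Fin.sum_univ_four]
  fin_cases i <;> fin_cases j <;> simp [rotMatrix] <;> ring

/-- A difference of two squares: the inner products of a with y and with its reflection have
difference 2(a·y - (x·y)(a·x)) and sum 2(x·y)(a·x). -/
theorem trace_rotMatrix_reflection {a x y : Fin 4 → ℝ} (ha : a ⬝ᵥ a = 1) (hx : x ⬝ᵥ x = 1)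
    (hy : y ⬝ᵥ y = 1) :
    ((rotMatrix a).transpose *
      (rotMatrix y - rotMatrix x * (rotMatrix y).transpose * rotMatrix x)).trace =
      16 * (x ⬝ᵥ y) * (a ⬝ᵥ x) * (a ⬝ᵥ y - (x ⬝ᵥ y) * (a ⬝ᵥ x)) := by
  rw [Matrix.mul_sub, Matrix.trace_sub, rotMatrix_mul_transpose_mul,
    trace_rotMatrix_transpose_mul, trace_rotMatrix_transpose_mul]
  simp only [dotProduct_sub, sub_dotProduct, dotProduct_smul, smul_dotProduct, smul_eq_mul, ha, hx,
    hy, dotProduct_comm y x]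
  ring

/-- Every rotation of angle less than `π` comes from a unit quaternion with positive real part. -/
theorem exists_rotMatrix_eq (R : SO3) (hR : 0 < 1 + (R : Matrix (Fin 3) (Fin 3) ℝ).trace) :
    ∃ q : Fin 4 → ℝ, 0 < q 0 ∧ q ⬝ᵥ q = 1 ∧ rotMatrix q = R ∧
      4 * q 0 ^ 2 = 1 + (R : Matrix (Fin 3) (Fin 3) ℝ).trace := by
  obtain ⟨M, hM⟩ := R
  rw [Matrix.mem_specialOrthogonalGroup_iff] at hM
  obtain ⟨hO, hdet⟩ := hM
  have h1 : M * M.transpose = 1 := (Matrix.mem_orthogonalGroup_iff _ _).1 hO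
  have h2 : M.transpose * M = 1 := (Matrix.mem_orthogonalGroup_iff' _ _).1 hO
  -- Since det M = 1, each entry equals its cofactor; these relations supplement orthonormality of
  -- rows and columns.
  have hadj : M.adjugate = M.transpose := by
    calc M.adjugate = M.adjugate * (M * M.transpose) := by rw [h1, mul_one]
      _ = M.transpose := by rw [← mul_assoc, Matrix.adjugate_mul, hdet, one_smul, one_mul]
  have r := fun i j => congrFun (congrFun h1 i) j
  have c := fun i j => congrFun (congrFun h2 i) j
  have d := fun i j => congrFun (congrFun hadj i) j
  rw [Matrix.adjugate_fin_three] at d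
  simp only [Matrix.mul_apply, Fin.sum_univ_three, Matrix.transpose_apply] at r c d
  have r00 := r 0 0
  have r11 := r 1 1
  have r22 := r 2 2
  have r01 := r 0 1
  have r02 := r 0 2
  have r12 := r 1 2
  have c00 := c 0 0
  have c11 := c 1 1
  have c22 := c 2 2
  have c01 := c 0 1
  have c02 := c 0 2
  have c12 := c 1 2
  have d00 := d 0 0
  have d11 := d 1 1
  have d22 := d 2 2
  have d01 := d 0 1
  have d10 := d 1 0
  have d02 := d 0 2
  have d20 := d 2 0
  have d12 := d 1 2
  have d21 := d 2 1
  clear r c d h1 h2 hadj hO hdet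
  simp at r00 r11 r22 r01 r02 r12 c00 c11 c22 c01 c02 c12
  simp at d00 d11 d22 d01 d10 d02 d20 d12 d21
  simp only [Matrix.trace, Fin.sum_univ_three, Matrix.diag_apply] at hR ⊢
  set τ : ℝ := 1 + (M 0 0 + M 1 1 + M 2 2) with hτ
  set w : ℝ := Real.sqrt τ / 2 with hw
  have hw0 : 0 < w := by positivity
  have hw2 : 4 * w ^ 2 = τ := by
    rw [hw, div_pow, Real.sq_sqrt hR.le]; ring
  have hne : w ≠ 0 := hw0.ne'
  have hsq : ∀ a b : ℝ, a / (4 * w) * (b / (4 * w)) = a * b / (4 * τ) := fun a b => by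
    rw [← hw2]; field_simp
  have hwm : ∀ a : ℝ, w * (a / (4 * w)) = a / 4 := fun a => by field_simp
  -- The vector part of the quaternion is the axial vector of M divided by 4w; its pairwise products
  -- must reproduce the symmetric part of M.
  have p11 := hsq (M 2 1 - M 1 2) (M 2 1 - M 1 2)
  have p22 := hsq (M 0 2 - M 2 0) (M 0 2 - M 2 0)
  have p33 := hsq (M 1 0 - M 0 1) (M 1 0 - M 0 1)
  have p12 := hsq (M 2 1 - M 1 2) (M 0 2 - M 2 0)
  have p13 := hsq (M 2 1 - M 1 2) (M 1 0 - M 0 1)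
  have p23 := hsq (M 0 2 - M 2 0) (M 1 0 - M 0 1)
  have p1 := hwm (M 2 1 - M 1 2)
  have p2 := hwm (M 0 2 - M 2 0)
  have p3 := hwm (M 1 0 - M 0 1)
  rw [show (M 2 1 - M 1 2) * (M 2 1 - M 1 2) = (1 + M 0 0 - M 1 1 - M 2 2) * τ by
    rw [hτ]; linear_combination r11 + r22 - c00 + 2 * d00] at p11
  rw [show (M 0 2 - M 2 0) * (M 0 2 - M 2 0) = (1 - M 0 0 + M 1 1 - M 2 2) * τ by
    rw [hτ]; linear_combination r00 + r22 - c11 + 2 * d11] at p22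
  rw [show (M 1 0 - M 0 1) * (M 1 0 - M 0 1) = (1 - M 0 0 - M 1 1 + M 2 2) * τ by
    rw [hτ]; linear_combination r00 + r11 - c22 + 2 * d22] at p33
  rw [show (M 2 1 - M 1 2) * (M 0 2 - M 2 0) = (M 1 0 + M 0 1) * τ by
    rw [hτ]; linear_combination d01 + d10 - r01 - c01] at p12
  rw [show (M 2 1 - M 1 2) * (M 1 0 - M 0 1) = (M 2 0 + M 0 2) * τ by
    rw [hτ]; linear_combination d02 + d20 - r02 - c02] at p13
  rw [show (M 0 2 - M 2 0) * (M 1 0 - M 0 1) = (M 2 1 + M 1 2) * τ by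
    rw [hτ]; linear_combination d12 + d21 - r12 - c12] at p23
  have hcan : ∀ a : ℝ, a * τ / (4 * τ) = a / 4 := fun a => by
    have := hR.ne'
    field_simp
  rw [hcan] at p11 p22 p33 p12 p13 p23
  refine ⟨![w, (M 2 1 - M 1 2) / (4 * w), (M 0 2 - M 2 0) / (4 * w), (M 1 0 - M 0 1) / (4 * w)],
    by simpa using hw0, ?_, ?_, by simpa using hw2⟩
  · simp only [dotProduct, Fin.sum_univ_four, Matrix.cons_val]
    rw [hτ] at hw2
    linear_combination hw2 / 4 + p11 + p22 + p33
  · generalize (M 2 1 - M 1 2) / (4 * w) = x at *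
    generalize (M 0 2 - M 2 0) / (4 * w) = y at *
    generalize (M 1 0 - M 0 1) / (4 * w) = z at *
    rw [hτ] at hw2
    ext i j
    fin_cases i <;> fin_cases j <;> simp [rotMatrix]
    · linear_combination hw2 / 4 + p11 - p22 - p33
    · linear_combination 2 * p12 - 2 * p3
    · linear_combination 2 * p13 + 2 * p2
    · linear_combination 2 * p12 + 2 * p3
    · linear_combination hw2 / 4 - p11 + p22 - p33
    · linear_combination 2 * p23 - 2 * p1
    · linear_combination 2 * p13 - 2 * p2
    · linear_combination 2 * p23 + 2 * p1
    · linear_combination hw2 / 4 - p11 - p22 + p33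

/-! ### Geodesic distance through half-angle cosines -/

/-- `cos² (d(R, Q) / 2)`. -/
def cosSq (R Q : SO3) : ℝ :=
  (1 + ((R : Matrix (Fin 3) (Fin 3) ℝ).transpose * (Q : Matrix (Fin 3) (Fin 3) ℝ)).trace) / 4

/-- `cos (d(R, Q) / 2)`. -/
def halfCos (R Q : SO3) : ℝ := Real.sqrt (cosSq R Q)

theorem geodDist_eq_arccos_cosSq (R Q : SO3) :
    geodDist R Q = Real.arccos (2 * cosSq R Q - 1) := by
  unfold geodDist cosSq
  congr 1
  ring

theorem cosSq_comm (R Q : SO3) : cosSq R Q = cosSq Q R := by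
  unfold cosSq
  rw [← Matrix.trace_transpose, Matrix.transpose_mul, Matrix.transpose_transpose]

theorem halfCos_comm (R Q : SO3) : halfCos R Q = halfCos Q R := by
  rw [halfCos, cosSq_comm, halfCos]

theorem geodDist_nonneg (R Q : SO3) : 0 ≤ geodDist R Q := Real.arccos_nonneg _

theorem trace_transpose_mul_le (R Q : SO3) :
    ((R : Matrix (Fin 3) (Fin 3) ℝ).transpose * (Q : Matrix (Fin 3) (Fin 3) ℝ)).trace ≤ 3 := by
  have hR : (R : Matrix (Fin 3) (Fin 3) ℝ).transpose * (R : Matrix (Fin 3) (Fin 3) ℝ) = 1 :=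
    (Matrix.mem_orthogonalGroup_iff' _ _).1 (Matrix.mem_specialOrthogonalGroup_iff.1 R.2).1
  have hQ : (Q : Matrix (Fin 3) (Fin 3) ℝ).transpose * (Q : Matrix (Fin 3) (Fin 3) ℝ) = 1 :=
    (Matrix.mem_orthogonalGroup_iff' _ _).1 (Matrix.mem_specialOrthogonalGroup_iff.1 Q.2).1
  have r := fun i => congrFun (congrFun hR i) i
  have q := fun i => congrFun (congrFun hQ i) i
  simp only [Matrix.mul_apply, Fin.sum_univ_three, Matrix.transpose_apply,
    Matrix.one_apply_eq] at r q
  simp only [Matrix.trace, Fin.sum_univ_three, Matrix.diag_apply, Matrix.mul_apply,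
    Matrix.transpose_apply]
  generalize (R : Matrix (Fin 3) (Fin 3) ℝ) = M at *
  generalize (Q : Matrix (Fin 3) (Fin 3) ℝ) = N at *
  have key : ∀ i, M 0 i * N 0 i + M 1 i * N 1 i + M 2 i * N 2 i ≤ 1 := fun i => by
    have h1 := r i
    have h2 := q i
    nlinarith [sq_nonneg (M 0 i - N 0 i), sq_nonneg (M 1 i - N 1 i), sq_nonneg (M 2 i - N 2 i)]
  linarith [key 0, key 1, key 2]

theorem cosSq_le_one (R Q : SO3) : cosSq R Q ≤ 1 := by
  unfold cosSq
  linarith [trace_transpose_mul_le R Q]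

theorem continuous_cosSq {α : Type*} [TopologicalSpace α] {f g : α → SO3} (hf : Continuous f)
    (hg : Continuous g) : Continuous fun a => cosSq (f a) (g a) := by
  unfold cosSq
  fun_prop

theorem continuous_geodDist {α : Type*} [TopologicalSpace α] {f g : α → SO3} (hf : Continuous f)
    (hg : Continuous g) : Continuous fun a => geodDist (f a) (g a) := by
  simp only [geodDist_eq_arccos_cosSq]
  exact Real.continuous_arccos.comp (((continuous_cosSq hf hg).const_mul 2).sub continuous_const)

/-- For `ρ < π`, an angle at most `ρ` is the same as a lower bound on the cosine. -/
theorem geodDist_le_iff {ρ : ℝ} (h0 : 0 ≤ ρ) (hπ : ρ < Real.pi) (R Q : SO3) :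
    geodDist R Q ≤ ρ ↔ Real.cos (ρ / 2) ^ 2 ≤ cosSq R Q := by
  have hc : Real.cos ρ = 2 * Real.cos (ρ / 2) ^ 2 - 1 := by
    rw [← Real.cos_two_mul]; congr 1; ring
  rw [geodDist_eq_arccos_cosSq]
  have h1 : 2 * cosSq R Q - 1 ≤ 1 := by linarith [cosSq_le_one R Q]
  constructor
  · intro h
    by_contra hlt
    push Not at hlt
    -- Below -1 `Real.arccos` takes the value π, which ρ < π excludes.
    by_cases h2 : -1 ≤ 2 * cosSq R Q - 1
    · have := Real.cos_le_cos_of_nonneg_of_le_pi (Real.arccos_nonneg _) hπ.le h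
      rw [Real.cos_arccos h2 h1] at this
      linarith
    · rw [Real.arccos_of_le_neg_one (by linarith)] at h
      linarith
  · intro h
    calc Real.arccos (2 * cosSq R Q - 1) ≤ Real.arccos (Real.cos ρ) :=
          Real.arccos_le_arccos (by linarith)
      _ = ρ := Real.arccos_cos h0 hπ.le

theorem exists_lift_of_geodDist_le {ρ : ℝ} (h0 : 0 ≤ ρ) (hπ : ρ < Real.pi) {R : SO3}
    (hR : geodDist 1 R ≤ ρ) :
    ∃ q : Fin 4 → ℝ, Real.cos (ρ / 2) ≤ q 0 ∧ q ⬝ᵥ q = 1 ∧ rotMatrix q = R := by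
  rw [geodDist_le_iff h0 hπ, cosSq] at hR
  have hcos : 0 < Real.cos (ρ / 2) := Real.cos_pos_of_mem_Ioo ⟨by linarith, by linarith⟩
  simp only [OneMemClass.coe_one, Matrix.transpose_one, one_mul] at hR
  obtain ⟨q, hq0, hq1, hqR, hqt⟩ := exists_rotMatrix_eq R (by
    have := pow_pos hcos 2
    linarith)
  exact ⟨q, by nlinarith, hq1, hqR⟩

/-- 2 + 2 x·y = |x + y|² ≥ (x₀ + y₀)² ≥ 4 cos²(ρ/2) = 2 + 2 cos ρ. -/
theorem dotProduct_ge_cos {ρ : ℝ} (h0 : 0 ≤ ρ) (hπ : ρ < Real.pi) {x y : Fin 4 → ℝ}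
    (hx : Real.cos (ρ / 2) ≤ x 0) (hx1 : x ⬝ᵥ x = 1) (hy : Real.cos (ρ / 2) ≤ y 0)
    (hy1 : y ⬝ᵥ y = 1) : Real.cos ρ ≤ x ⬝ᵥ y := by
  have hc : Real.cos ρ = 2 * Real.cos (ρ / 2) ^ 2 - 1 := by
    rw [← Real.cos_two_mul]; congr 1; ring
  have hcos : 0 < Real.cos (ρ / 2) := Real.cos_pos_of_mem_Ioo ⟨by linarith, by linarith⟩
  simp only [dotProduct, Fin.sum_univ_four] at *
  have hs : (2 * Real.cos (ρ / 2)) ^ 2 ≤ (x 0 + y 0) ^ 2 :=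
    pow_le_pow_left₀ (by linarith) (by linarith) 2
  nlinarith [sq_nonneg (x 1 + y 1), sq_nonneg (x 2 + y 2), sq_nonneg (x 3 + y 3)]

theorem cosSq_eq_of_lift {R Q : SO3} {x y : Fin 4 → ℝ} (hx1 : x ⬝ᵥ x = 1) (hxR : rotMatrix x = R)
    (hy1 : y ⬝ᵥ y = 1) (hyQ : rotMatrix y = Q) : cosSq R Q = (x ⬝ᵥ y) ^ 2 := by
  rw [cosSq, ← hxR, ← hyQ, trace_rotMatrix_transpose_mul, hx1, hy1]
  ring

theorem halfCos_eq_of_lift {R Q : SO3} {x y : Fin 4 → ℝ} (hx1 : x ⬝ᵥ x = 1)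
    (hxR : rotMatrix x = R) (hy1 : y ⬝ᵥ y = 1) (hyQ : rotMatrix y = Q) (hxy : 0 ≤ x ⬝ᵥ y) :
    halfCos R Q = x ⬝ᵥ y := by
  rw [halfCos, cosSq_eq_of_lift hx1 hxR hy1 hyQ, Real.sqrt_sq hxy]

/-- The bound ρ ≤ π/2 makes the inner product of the two lifts non-negative, which removes the sign
ambiguity of the square root. -/
theorem cos_le_halfCos {ρ : ℝ} (h0 : 0 ≤ ρ) (hπ : ρ ≤ Real.pi / 2) {R Q : SO3}
    (hR : geodDist 1 R ≤ ρ) (hQ : geodDist 1 Q ≤ ρ) : Real.cos ρ ≤ halfCos R Q := by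
  have hρ : ρ < Real.pi := by linarith [Real.pi_pos]
  obtain ⟨x, hx0, hx1, hxR⟩ := exists_lift_of_geodDist_le h0 hρ hR
  obtain ⟨y, hy0, hy1, hyQ⟩ := exists_lift_of_geodDist_le h0 hρ hQ
  have h := dotProduct_ge_cos h0 hρ hx0 hx1 hy0 hy1
  have hc : 0 ≤ Real.cos ρ := Real.cos_nonneg_of_neg_pi_div_two_le_of_le (by linarith) hπ
  rwa [halfCos_eq_of_lift hx1 hxR hy1 hyQ (hc.trans h)]

theorem halfCos_le_one (R Q : SO3) : halfCos R Q ≤ 1 :=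
  Real.sqrt_le_one.2 (cosSq_le_one R Q)

theorem halfCos_nonneg (R Q : SO3) : 0 ≤ halfCos R Q := Real.sqrt_nonneg _

theorem cosSq_nonneg {R Q : SO3} (hR : geodDist 1 R ≤ Real.pi / 2)
    (hQ : geodDist 1 Q ≤ Real.pi / 2) : 0 ≤ cosSq R Q := by
  have h0 : 0 ≤ Real.pi / 2 := by positivity
  have hρ : Real.pi / 2 < Real.pi := by linarith [Real.pi_pos]
  obtain ⟨x, -, hx1, hxR⟩ := exists_lift_of_geodDist_le h0 hρ hR
  obtain ⟨y, -, hy1, hyQ⟩ := exists_lift_of_geodDist_le h0 hρ hQ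
  rw [cosSq_eq_of_lift hx1 hxR hy1 hyQ]
  positivity

theorem halfCos_sq {R Q : SO3} (hR : geodDist 1 R ≤ Real.pi / 2)
    (hQ : geodDist 1 Q ≤ Real.pi / 2) : halfCos R Q ^ 2 = cosSq R Q :=
  Real.sq_sqrt (cosSq_nonneg hR hQ)

/-- The direction from `R` to `Q` in `T_R SO(3)`, namely `Q - R Qᵀ R = 2 sin θ / θ • log_R Q`. -/
def toward (R Q : SO3) : Matrix (Fin 3) (Fin 3) ℝ :=
  (Q : Matrix (Fin 3) (Fin 3) ℝ) -
    (R : Matrix (Fin 3) (Fin 3) ℝ) * (Q : Matrix (Fin 3) (Fin 3) ℝ).transpose * R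

theorem trace_transpose_mul_toward {A R Q : SO3} (hA : geodDist 1 A ≤ Real.pi / 2)
    (hR : geodDist 1 R ≤ Real.pi / 2) (hQ : geodDist 1 Q ≤ Real.pi / 2) :
    ((A : Matrix (Fin 3) (Fin 3) ℝ).transpose * toward R Q).trace =
      16 * halfCos R Q * halfCos A R * (halfCos A Q - halfCos R Q * halfCos A R) := by
  have h0 : 0 ≤ Real.pi / 2 := by positivity
  have hρ : Real.pi / 2 < Real.pi := by linarith [Real.pi_pos]
  obtain ⟨a, ha, ha1, haA⟩ := exists_lift_of_geodDist_le h0 hρ hA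
  obtain ⟨x, hx, hx1, hxR⟩ := exists_lift_of_geodDist_le h0 hρ hR
  obtain ⟨y, hy, hy1, hyQ⟩ := exists_lift_of_geodDist_le h0 hρ hQ
  have hax := dotProduct_ge_cos h0 hρ ha ha1 hx hx1
  have hay := dotProduct_ge_cos h0 hρ ha ha1 hy hy1
  have hxy := dotProduct_ge_cos h0 hρ hx hx1 hy hy1
  rw [Real.cos_pi_div_two] at hax hay hxy
  rw [halfCos_eq_of_lift hx1 hxR hy1 hyQ hxy, halfCos_eq_of_lift ha1 haA hx1 hxR hax,
    halfCos_eq_of_lift ha1 haA hy1 hyQ hay, toward, ← haA, ← hxR, ← hyQ,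
    trace_rotMatrix_reflection ha1 hx1 hy1]

/-- For unit vectors 1 - a·x = |a - x|²/2, so this is |a - x|² ≤ 2|a - y|² + 2|x - y|², a substitute
for the triangle inequality. -/
theorem one_sub_halfCos_le {R Q S : SO3} (hR : geodDist 1 R ≤ Real.pi / 2)
    (hQ : geodDist 1 Q ≤ Real.pi / 2) (hS : geodDist 1 S ≤ Real.pi / 2) :
    1 - halfCos R S ≤ 2 * ((1 - halfCos R Q) + (1 - halfCos S Q)) := by
  have h0 : 0 ≤ Real.pi / 2 := by positivity
  have hρ : Real.pi / 2 < Real.pi := by linarith [Real.pi_pos]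
  obtain ⟨a, ha, ha1, haR⟩ := exists_lift_of_geodDist_le h0 hρ hR
  obtain ⟨x, hx, hx1, hxS⟩ := exists_lift_of_geodDist_le h0 hρ hS
  obtain ⟨y, hy, hy1, hyQ⟩ := exists_lift_of_geodDist_le h0 hρ hQ
  have hax := dotProduct_ge_cos h0 hρ ha ha1 hx hx1
  have hay := dotProduct_ge_cos h0 hρ ha ha1 hy hy1
  have hxy := dotProduct_ge_cos h0 hρ hx hx1 hy hy1
  rw [Real.cos_pi_div_two] at hax hay hxy
  rw [halfCos_eq_of_lift hx1 hxS hy1 hyQ hxy, halfCos_eq_of_lift ha1 haR hx1 hxS hax,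
    halfCos_eq_of_lift ha1 haR hy1 hyQ hay]
  simp only [dotProduct, Fin.sum_univ_four] at *
  nlinarith [sq_nonneg (a 0 + x 0 - 2 * y 0), sq_nonneg (a 1 + x 1 - 2 * y 1),
    sq_nonneg (a 2 + x 2 - 2 * y 2), sq_nonneg (a 3 + x 3 - 2 * y 3)]

instance : CompactSpace SO3 := by
  refine isCompact_iff_compactSpace.1 ?_
  have hcl : IsClosed (Matrix.specialOrthogonalGroup (Fin 3) ℝ : Set (Matrix (Fin 3) (Fin 3) ℝ)) := by
    have : (Matrix.specialOrthogonalGroup (Fin 3) ℝ : Set (Matrix (Fin 3) (Fin 3) ℝ)) =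
        {M | M * M.transpose = 1} ∩ {M | M.det = 1} := by
      ext M
      simp [Matrix.mem_specialOrthogonalGroup_iff, Matrix.mem_orthogonalGroup_iff]
    rw [this]
    exact (isClosed_eq (by fun_prop) continuous_const).inter
      (isClosed_eq (by fun_prop) continuous_const)
  have hK : IsCompact (Set.univ.pi fun _ : Fin 3 => Set.univ.pi fun _ : Fin 3 => Set.Icc (-1 : ℝ) 1) :=
    isCompact_univ_pi fun _ => isCompact_univ_pi fun _ => isCompact_Icc
  refine hK.of_isClosed_subset hcl fun (M : Matrix (Fin 3) (Fin 3) ℝ) hM => ?_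
  have h : M * M.transpose = 1 :=
    (Matrix.mem_orthogonalGroup_iff _ _).1 (Matrix.mem_specialOrthogonalGroup_iff.1 hM).1
  intro i _ j _
  have hi := congrFun (congrFun h i) i
  simp only [Matrix.mul_apply, Matrix.one_apply_eq, Matrix.transpose_apply] at hi
  have hj : M i j ^ 2 ≤ 1 := by
    rw [← hi, sq]
    exact Finset.single_le_sum (f := fun j => M i j * M i j) (fun k _ => mul_self_nonneg _)
      (Finset.mem_univ j)
  exact abs_le.1 ((sq_le_one_iff_abs_le_one _).1 hj)

-- Gradient of the interaction potential

attribute [local instance] Matrix.linftyOpNormedRing Matrix.linftyOpNormedAlgebra in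
theorem hasDerivAt_exp_smul_hat (v : Fin 3 → ℝ) (i j : Fin 3) :
    HasDerivAt (fun t : ℝ => NormedSpace.exp (hat (t • v)) i j) (hat v i j) 0 := by
  have h := hasDerivAt_exp_smul_const (𝕂 := ℝ) (hat v) 0
  rw [zero_smul, NormedSpace.exp_zero, one_mul] at h
  simp only [hat_smul]
  exact hasDerivAt_pi.1 (hasDerivAt_pi.1 h i) j

/-- With `Real.sinc` the case split at 0 disappears, and continuity there comes for free. -/
theorem hFun_eq (g : ℝ → ℝ) (s : ℝ) : hFun g s = (Real.sinc s)⁻¹ * dg g (s ^ 2) := by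
  unfold hFun
  split_ifs with h
  · simp [h]
  · rw [Real.sinc_of_ne_zero h, inv_div]

theorem sinc_pos_of_nonneg_of_lt_pi {s : ℝ} (h0 : 0 ≤ s) (hπ : s < Real.pi) : 0 < Real.sinc s := by
  rcases h0.eq_or_lt with rfl | h
  · simp
  · rw [Real.sinc_of_ne_zero h.ne']
    exact div_pos (Real.sin_pos_of_pos_of_lt_pi h hπ) h

theorem hFun_nonneg {g : ℝ → ℝ} (hg : ∀ s, 0 ≤ s → 0 ≤ dg g s) {s : ℝ} (h0 : 0 ≤ s)
    (hπ : s < Real.pi) : 0 ≤ hFun g s := by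
  rw [hFun_eq]
  exact mul_nonneg (inv_nonneg.2 (sinc_pos_of_nonneg_of_lt_pi h0 hπ).le) (hg _ (sq_nonneg s))

theorem continuousOn_hFun {g : ℝ → ℝ} (hg : ContinuousOn (dg g) (Ici 0)) :
    ContinuousOn (hFun g) (Ico 0 Real.pi) := by
  have : hFun g = fun s => (Real.sinc s)⁻¹ * dg g (s ^ 2) := funext (hFun_eq g)
  rw [this]
  exact (Real.continuous_sinc.continuousOn.inv₀ fun s hs =>
    (sinc_pos_of_nonneg_of_lt_pi hs.1 hs.2).ne').mul
    (hg.comp (by fun_prop) fun s _ => sq_nonneg s)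

/-- Derivative of `cos² (d / 2)` in its first argument, along a geodesic. -/
theorem hasDerivAt_cosSq_mul_expHat (R Q : SO3) (v : Fin 3 → ℝ) :
    HasDerivAt (fun t : ℝ => cosSq (R * expHat (t • v)) Q)
      ((∑ i, ∑ j, hat v i j * ((R : Matrix (Fin 3) (Fin 3) ℝ).transpose *
        (Q : Matrix (Fin 3) (Fin 3) ℝ)) i j) / 4) 0 := by
  set B := (R : Matrix (Fin 3) (Fin 3) ℝ).transpose * (Q : Matrix (Fin 3) (Fin 3) ℝ) with hB
  have heq : (fun t : ℝ => cosSq (R * expHat (t • v)) Q) =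
      fun t => (1 + ∑ i, ∑ j, NormedSpace.exp (hat (t • v)) i j * B i j) / 4 := by
    funext t
    unfold cosSq
    have : ((R * expHat (t • v) : SO3) : Matrix (Fin 3) (Fin 3) ℝ) =
      (R : Matrix (Fin 3) (Fin 3) ℝ) * NormedSpace.exp (hat (t • v)) := rfl
    rw [this, Matrix.transpose_mul, mul_assoc, ← hB, Matrix.trace, Finset.sum_comm]
    simp only [Matrix.diag_apply, Matrix.mul_apply, Matrix.transpose_apply]
  rw [heq]
  refine HasDerivAt.div_const (HasDerivAt.const_add _ (HasDerivAt.fun_sum fun i _ =>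
    HasDerivAt.fun_sum fun j _ => (hasDerivAt_exp_smul_hat v i j).mul_const _)) _

theorem expHat_zero : expHat 0 = 1 := by
  ext1
  have : hat 0 = 0 := by simpa using hat_smul 0 0
  simp [expHat, this]

theorem sq_arccos_le {u : ℝ} (hu : u ≤ 1) : Real.arccos u ^ 2 ≤ Real.pi ^ 2 / 2 * (1 - u) := by
  have hπ := Real.pi_pos
  rcases le_total (-1) u with h | h
  · have h1 := Real.cos_le_one_sub_mul_cos_sq (x := Real.arccos u) (by
      rw [abs_of_nonneg (Real.arccos_nonneg u)]; exact Real.arccos_le_pi u)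
    rw [Real.cos_arccos h hu] at h1
    field_simp at h1 ⊢
    nlinarith
  · rw [Real.arccos_of_le_neg_one h]
    nlinarith [sq_nonneg Real.pi]

theorem hasDerivAt_geodDist_sq (R Q : SO3) (hRQ : geodDist R Q < Real.pi) (v : Fin 3 → ℝ) :
    HasDerivAt (fun t : ℝ => geodDist (R * expHat (t • v)) Q ^ 2)
      (-(Real.sinc (geodDist R Q))⁻¹ *
        (∑ i, ∑ j, hat v i j * ((R : Matrix (Fin 3) (Fin 3) ℝ).transpose *
          (Q : Matrix (Fin 3) (Fin 3) ℝ)) i j)) 0 := by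
  have hc := hasDerivAt_cosSq_mul_expHat R Q v
  set β := ∑ i, ∑ j, hat v i j * ((R : Matrix (Fin 3) (Fin 3) ℝ).transpose *
          (Q : Matrix (Fin 3) (Fin 3) ℝ)) i j
  have h0 : R * expHat ((0 : ℝ) • v) = R := by rw [zero_smul, expHat_zero, mul_one]
  simp only [geodDist_eq_arccos_cosSq] at hRQ ⊢
  set c : ℝ → ℝ := fun t => cosSq (R * expHat (t • v)) Q with hcdef
  have hc0 : c 0 = cosSq R Q := by simp only [hcdef, h0]
  have hu : HasDerivAt (fun t => 2 * c t - 1) (2 * (β / 4)) 0 := (hc.const_mul 2).sub_const 1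
  rw [← hc0] at hRQ ⊢
  have hle : ∀ t, 2 * c t - 1 ≤ 1 := fun t => by
    have := cosSq_le_one (R * expHat (t • v)) Q
    simp only [hcdef]; linarith
  have hgt : -1 < 2 * c 0 - 1 := by
    by_contra h
    push Not at h
    rw [Real.arccos_of_le_neg_one h] at hRQ
    exact lt_irrefl _ hRQ
  rcases (hle 0).eq_or_lt with h1 | h1
  -- At distance 0 `Real.arccos` is not differentiable. There `cosSq` is maximal, so its derivative
  -- vanishes, and d² is bounded by a multiple of its deficit.
  · have hβ : 2 * (β / 4) = 0 := IsLocalMax.hasDerivAt_eq_zero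
      (Filter.Eventually.of_forall fun t => by simpa only [h1] using hle t) hu
    have hβ0 : β = 0 := by linarith
    rw [hβ0, mul_zero]
    rw [hβ] at hu
    rw [hasDerivAt_iff_isLittleO] at hu ⊢
    refine Asymptotics.IsBigO.trans_isLittleO ?_ hu
    refine Asymptotics.IsBigO.of_bound (Real.pi ^ 2 / 2) (Filter.Eventually.of_forall fun t => ?_)
    rw [h1, Real.arccos_one]
    simp only [ne_eq, OfNat.ofNat_ne_zero, not_false_eq_true, zero_pow, sub_zero, smul_zero,
      Real.norm_eq_abs]
    rw [abs_of_nonneg (sq_nonneg _), abs_of_nonpos (by linarith [hle t])]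
    linarith [sq_arccos_le (hle t)]
  · have ha := HasDerivAt.comp (h₂ := Real.arccos) (0 : ℝ)
      (Real.hasDerivAt_arccos hgt.ne' h1.ne) hu
    refine (ha.fun_pow 2).congr_deriv (Eq.symm ?_)
    have hpos : Real.arccos (2 * c 0 - 1) ≠ 0 := (Real.arccos_pos.2 h1).ne'
    rw [Real.sinc_of_ne_zero hpos, Real.sin_arccos, Function.comp_apply]
    field_simp
    ring

/-- Pairing B with the basis ê_k reads off its skew part; for B = RᵀQ, multiplying by R yields
`toward R Q`. -/
theorem hat_sum_mul (B : Matrix (Fin 3) (Fin 3) ℝ) :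
    hat (fun k => ∑ i, ∑ j, hat (Pi.single k 1) i j * B i j) = B - B.transpose := by
  ext i j
  fin_cases i <;> fin_cases j <;> simp [hat, Fin.sum_univ_three] <;> ring

/-- The gradient of `K_Q` away from the cut locus of `Q`. -/
theorem grad_potential {g : ℝ → ℝ} (hg : DifferentiableOn ℝ g (Ici 0)) (R Q : SO3)
    (hRQ : geodDist R Q < Real.pi) :
    grad (fun S => potential g S Q) R = -hFun g (geodDist R Q) • toward R Q := by
  have h0 : ∀ v : Fin 3 → ℝ, R * expHat ((0 : ℝ) • v) = R := fun v => by
    rw [zero_smul, expHat_zero, mul_one]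
  have hd : ∀ v : Fin 3 → ℝ, deriv (fun t : ℝ => potential g (R * expHat (t • v)) Q) 0 =
      -hFun g (geodDist R Q) * ∑ i, ∑ j, hat v i j * ((R : Matrix (Fin 3) (Fin 3) ℝ).transpose *
          (Q : Matrix (Fin 3) (Fin 3) ℝ)) i j := by
    intro v
    have hg0 : HasDerivWithinAt g (dg g (geodDist R Q ^ 2)) (Ici 0)
        (geodDist (R * expHat ((0 : ℝ) • v)) Q ^ 2) := by
      rw [h0]
      exact (hg _ (mem_Ici.2 (sq_nonneg _))).hasDerivWithinAt
    have h := hg0.scomp_hasDerivAt (0 : ℝ) (hasDerivAt_geodDist_sq R Q hRQ v)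
      (fun t => sq_nonneg _)
    have h' : HasDerivAt (fun t : ℝ => potential g (R * expHat (t • v)) Q) _ 0 := h
    rw [h'.deriv, hFun_eq, smul_eq_mul]
    ring
  have hRR : (R : Matrix (Fin 3) (Fin 3) ℝ) * (R : Matrix (Fin 3) (Fin 3) ℝ).transpose = 1 :=
    (Matrix.mem_orthogonalGroup_iff _ _).1 (Matrix.mem_specialOrthogonalGroup_iff.1 R.2).1
  unfold grad
  simp only [hd]
  have := hat_smul (-hFun g (geodDist R Q)) (fun k => ∑ i, ∑ j, hat (Pi.single k 1) i j *
    ((R : Matrix (Fin 3) (Fin 3) ℝ).transpose * (Q : Matrix (Fin 3) (Fin 3) ℝ)) i j)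
  rw [hat_sum_mul] at this
  have hfun : (fun k => -hFun g (geodDist R Q) * ∑ i, ∑ j, hat (Pi.single k 1) i j *
    ((R : Matrix (Fin 3) (Fin 3) ℝ).transpose * (Q : Matrix (Fin 3) (Fin 3) ℝ)) i j) =
    (-hFun g (geodDist R Q)) • (fun k => ∑ i, ∑ j, hat (Pi.single k 1) i j *
    ((R : Matrix (Fin 3) (Fin 3) ℝ).transpose * (Q : Matrix (Fin 3) (Fin 3) ℝ)) i j) := rfl
  rw [hfun, this, Matrix.mul_smul, Matrix.mul_sub, Matrix.transpose_mul, Matrix.transpose_transpose,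
    ← mul_assoc, hRR, one_mul, ← mul_assoc, toward]

/-! ### Differential inequalities for families of functions -/

/-- A Grönwall-type lower bound: if `f' ≥ -C (f - m) + δ` then `f` stays above the
solution of the corresponding linear equation. -/
theorem le_of_deriv_ge_relaxation {f f' : ℝ → ℝ} {C δ m s t : ℝ} (hC : 0 < C) (hst : s ≤ t)
    (hs : 0 ≤ s) (hf : ∀ τ, 0 ≤ τ → HasDerivWithinAt f (f' τ) (Ici 0) τ)
    (hf' : ∀ τ ∈ Icc s t, -C * (f τ - m) + δ ≤ f' τ) :
    m + δ / C * (1 - Real.exp (-C * (t - s))) + Real.exp (-C * (t - s)) * (f s - m) ≤ f t := by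
  -- Integrating factor, centred at the equilibrium m + δ/C.
  have hmono : MonotoneOn (fun τ => Real.exp (C * τ) * (f τ - m - δ / C)) (Icc s t) := by
    have hd : ∀ τ ∈ Icc s t, HasDerivWithinAt (fun τ => Real.exp (C * τ) * (f τ - m - δ / C))
        (Real.exp (C * τ) * C * (f τ - m - δ / C) + Real.exp (C * τ) * f' τ) (Ici 0) τ := by
      intro τ hτ
      have h1 : HasDerivWithinAt (fun τ => Real.exp (C * τ)) (Real.exp (C * τ) * C) (Ici 0) τ := by
        have := ((hasDerivAt_id τ).const_mul C).exp
        simpa using this.hasDerivWithinAt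
      exact h1.mul (((hf τ (hs.trans hτ.1)).sub_const m).sub_const (δ / C))
    refine monotoneOn_of_hasDerivWithinAt_nonneg (convex_Icc s t)
      (f' := fun τ => Real.exp (C * τ) * C * (f τ - m - δ / C) + Real.exp (C * τ) * f' τ)
      (fun τ hτ => ((hd τ hτ).continuousWithinAt).mono fun x hx => hs.trans hx.1) ?_ ?_
    · intro τ hτ
      exact (hd τ (interior_subset hτ)).mono fun x hx => hs.trans (interior_subset hx).1
    · intro τ hτ
      have h1 := hf' τ (interior_subset hτ)
      have h2 : Real.exp (C * τ) * C * (f τ - m - δ / C) + Real.exp (C * τ) * f' τ =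
          Real.exp (C * τ) * (f' τ - (-C * (f τ - m) + δ)) := by
        field_simp
        ring
      rw [h2]
      exact mul_nonneg (Real.exp_pos _).le (by linarith)
  have h := hmono ⟨le_rfl, hst⟩ ⟨hst, le_rfl⟩ hst
  simp only at h
  have he : Real.exp (-C * (t - s)) * Real.exp (C * t) = Real.exp (C * s) := by
    rw [← Real.exp_add]; congr 1; ring
  have hpos := Real.exp_pos (C * t)
  have h3 : Real.exp (C * t) * (Real.exp (-C * (t - s)) * (f s - m - δ / C)) ≤
      Real.exp (C * t) * (f t - m - δ / C) := by
    rw [← mul_assoc, mul_comm (Real.exp (C * t)), he]; exact h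
  have h4 := le_of_mul_le_mul_left h3 hpos
  linarith

/-- If each `f i` is pulled up towards every common lower bound no slower than `-C (f i - m)`, then
common lower bounds persist. -/
theorem lower_bound_persists {ι : Type*} {f f' : ι → ℝ → ℝ} {C b s t m : ℝ} (hC : 0 < C)
    (hs : 0 ≤ s) (hst : s ≤ t) (hb : ∀ i τ, 0 ≤ τ → b ≤ f i τ)
    (hf : ∀ i τ, 0 ≤ τ → HasDerivWithinAt (f i) (f' i τ) (Ici 0) τ)
    (hf' : ∀ τ, 0 ≤ τ → ∀ m, b ≤ m → (∀ j, m ≤ f j τ) → ∀ i, -C * (f i τ - m) ≤ f' i τ)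
    (hm : ∀ j, m ≤ f j s) (i : ι) : m ≤ f i t := by
  -- The infimum over all indices and times is itself a common lower bound, so Grönwall applies with
  -- it; were it below m, every value would exceed it by a fixed amount. No minimising index is
  -- needed.
  let V : Set ℝ := {v | ∃ j, ∃ τ ∈ Icc s t, f j τ = v}
  have hVne : V.Nonempty := ⟨f i t, i, t, ⟨hst, le_rfl⟩, rfl⟩
  have hVb : BddBelow V := ⟨b, by rintro _ ⟨j, τ, hτ, rfl⟩; exact hb j τ (hs.trans hτ.1)⟩
  set μ := sInf V with hμ
  have hbμ : b ≤ μ := le_csInf hVne (by rintro _ ⟨j, τ, hτ, rfl⟩; exact hb j τ (hs.trans hτ.1))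
  have hμle : ∀ j, ∀ τ ∈ Icc s t, μ ≤ f j τ := fun j τ hτ => csInf_le hVb ⟨j, τ, hτ, rfl⟩
  suffices h : m ≤ μ from h.trans (hμle i t ⟨hst, le_rfl⟩)
  by_contra hlt
  push Not at hlt
  set E := Real.exp (-C * (t - s)) with hE
  have hEpos : 0 < E := Real.exp_pos _
  have hkey : μ + E * (m - μ) ≤ μ := by
    conv_rhs => rw [hμ]
    refine le_csInf hVne ?_
    rintro _ ⟨j, τ, hτ, rfl⟩
    have h1 := le_of_deriv_ge_relaxation (f := fun τ => f j τ)
      (δ := 0) (m := μ) (C := C) (f' := f' j) hC hτ.1 hs (hf j)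
      (fun x hx => by
        have := hf' x (hs.trans hx.1) μ hbμ (fun k => hμle k x ⟨hx.1, hx.2.trans hτ.2⟩) j
        linarith)
    have h2 : E ≤ Real.exp (-C * (τ - s)) := Real.exp_le_exp.2 (by nlinarith [hτ.2])
    have h3 : E * (m - μ) ≤ Real.exp (-C * (τ - s)) * (f j s - μ) :=
      mul_le_mul h2 (by linarith [hm j]) (by linarith) (Real.exp_pos _).le
    simp only [zero_div, zero_mul, add_zero] at h1
    linarith
  nlinarith

/-- If common lower bounds in `[b, 1 - η]` are moreover pushed up at a uniform rate, then all `f i`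
eventually exceed `1 - η`, uniformly in `i`. -/
theorem eventually_one_sub_le {ι : Type*} {f f' : ι → ℝ → ℝ} {C b : ℝ} (hC : 0 < C)
    (hb : ∀ i τ, 0 ≤ τ → b ≤ f i τ)
    (hf : ∀ i τ, 0 ≤ τ → HasDerivWithinAt (f i) (f' i τ) (Ici 0) τ)
    (hf' : ∀ τ, 0 ≤ τ → ∀ m, b ≤ m → (∀ j, m ≤ f j τ) → ∀ i, -C * (f i τ - m) ≤ f' i τ)
    (hgain : ∀ η > 0, ∃ K > 0, ∃ δ > 0, ∀ τ, 0 ≤ τ → ∀ m, b ≤ m → m ≤ 1 - η →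
      (∀ j, m ≤ f j τ) → ∀ i, -K * (f i τ - m) + δ ≤ f' i τ) {η : ℝ} (hη : 0 < η) :
    ∃ T, 0 ≤ T ∧ ∀ t, T ≤ t → ∀ i, 1 - η ≤ f i t := by
  obtain ⟨K, hK, δ, hδ, hgain⟩ := hgain η hη
  have persist := fun {s t m} (hs : 0 ≤ s) (hst : s ≤ t) (hm : ∀ j, m ≤ f j s) (i : ι) =>
    lower_bound_persists hC hs hst hb hf hf' hm i
  by_cases hbη : 1 - η ≤ b
  · exact ⟨0, le_rfl, fun t ht i => hbη.trans (hb i t ht)⟩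
  push Not at hbη
  -- The gain over one unit of time: the common lower bound rises by γ at each integer time until it
  -- reaches 1 - η.
  set γ := δ / K * (1 - Real.exp (-K)) with hγ
  have hγ0 : 0 < γ := mul_pos (by positivity) (by simpa using hK)
  have step : ∀ n : ℕ, ∀ i, min (b + n * γ) (1 - η) ≤ f i n := by
    intro n
    induction n with
    | zero =>
      intro i
      simpa using Or.inl (hb i 0 le_rfl)
    | succ n ih =>
      intro i
      have hn : (0 : ℝ) ≤ n := n.cast_nonneg
      set m := min (b + n * γ) (1 - η) with hm
      have hbm : b ≤ m := le_min (by nlinarith) hbη.le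
      have h := le_of_deriv_ge_relaxation (f := f i) (f' := f' i) (C := K) (δ := δ) (m := m)
        (s := n) (t := n + 1) hK (by linarith) hn (hf i) (fun x hx =>
          hgain x (hn.trans hx.1) m hbm (min_le_right _ _)
            (fun j => persist hn hx.1 ih j) i)
      have h1 : 0 ≤ Real.exp (-K * ((n : ℝ) + 1 - n)) * (f i n - m) :=
        mul_nonneg (Real.exp_pos _).le (by linarith [ih i])
      have h2 : -K * ((n : ℝ) + 1 - n) = -K := by ring
      rw [h2] at h h1
      push_cast
      rcases min_choice (b + n * γ) (1 - η) with h3 | h3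
      · exact (min_le_left _ _).trans (by rw [hm, h3] at h; rw [hm, h3] at h1; linarith)
      · exact (min_le_right _ _).trans (by rw [hm, h3] at h; rw [hm, h3] at h1; linarith)
  obtain ⟨N, hN⟩ := exists_nat_gt ((1 - η - b) / γ)
  rw [div_lt_iff₀ hγ0] at hN
  refine ⟨N, N.cast_nonneg, fun t ht i => persist N.cast_nonneg ht (fun j => ?_) i⟩
  have := step N j
  rwa [min_eq_right (by linarith)] at this

/-! ### Pull between particles and the velocity field -/

/-- The contribution of a particle at `Q` to the time derivative of `cos² (d(A, R) / 2)`, for a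
particle moving through `R`. -/
def pull (g : ℝ → ℝ) (A R Q : SO3) : ℝ :=
  hFun g (geodDist R Q) * ((A : Matrix (Fin 3) (Fin 3) ℝ).transpose * toward R Q).trace / 4

/-- Keeps pairs in the disk off the cut locus: 2ρ < π. -/
theorem geodDist_le_two_mul {ρ : ℝ} (h0 : 0 ≤ ρ) (hπ : ρ < Real.pi / 2) {R Q : SO3}
    (hR : geodDist 1 R ≤ ρ) (hQ : geodDist 1 Q ≤ ρ) : geodDist R Q ≤ 2 * ρ := by
  rw [geodDist_le_iff (by linarith) (by linarith), mul_div_cancel_left₀ _ two_ne_zero,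
    ← halfCos_sq (hR.trans hπ.le) (hQ.trans hπ.le)]
  exact pow_le_pow_left₀ (Real.cos_nonneg_of_neg_pi_div_two_le_of_le (by linarith) hπ.le)
    (cos_le_halfCos h0 hπ.le hR hQ) 2

theorem exists_hFun_le {g : ℝ → ℝ} (hg : ContinuousOn (dg g) (Ici 0)) {ρ : ℝ}
    (hπ : ρ < Real.pi / 2) : ∃ H > 0, ∀ s ∈ Icc 0 (2 * ρ), hFun g s ≤ H := by
  obtain ⟨B, hB⟩ := (isCompact_Icc (a := (0 : ℝ)) (b := 2 * ρ)).bddAbove_image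
    ((continuousOn_hFun hg).mono fun s hs => ⟨hs.1, by linarith [hs.2]⟩)
  refine ⟨max B 1, by positivity, fun s hs => ?_⟩
  exact (hB ⟨s, hs, rfl⟩).trans (le_max_left _ _)

theorem continuous_toward (R : SO3) : Continuous (toward R) := by
  unfold toward
  fun_prop

theorem pull_eq {g : ℝ → ℝ} {A R Q : SO3} (hA : geodDist 1 A ≤ Real.pi / 2)
    (hR : geodDist 1 R ≤ Real.pi / 2) (hQ : geodDist 1 Q ≤ Real.pi / 2) :
    pull g A R Q = 4 * hFun g (geodDist R Q) * halfCos R Q * halfCos A R *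
      (halfCos A Q - halfCos R Q * halfCos A R) := by
  rw [pull, trace_transpose_mul_toward hA hR hQ]
  ring

/-- Replace w by k in 4 h z u (w - z u) and split k - z u = k(1 - z) - z(u - k). The second part
costs at most 4H(u² - k²) because u(u - k) ≤ u² - k². -/
theorem pull_ge {g : ℝ → ℝ} {H k : ℝ} {A R Q : SO3} (hA : geodDist 1 A ≤ Real.pi / 2)
    (hR : geodDist 1 R ≤ Real.pi / 2) (hQ : geodDist 1 Q ≤ Real.pi / 2)
    (h0 : 0 ≤ hFun g (geodDist R Q)) (hH : hFun g (geodDist R Q) ≤ H) (hk : 0 ≤ k)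
    (hkR : k ≤ halfCos A R) (hkQ : k ≤ halfCos A Q) :
    -(4 * H) * (cosSq A R - k ^ 2) + 4 * halfCos A R * k *
      (hFun g (geodDist R Q) * (halfCos R Q * (1 - halfCos R Q))) ≤ pull g A R Q := by
  rw [pull_eq hA hR hQ, ← halfCos_sq hA hR]
  have hz0 := halfCos_nonneg R Q
  have hz1 := halfCos_le_one R Q
  set h := hFun g (geodDist R Q)
  set z := halfCos R Q
  set u := halfCos A R
  set w := halfCos A Q
  have hu : 0 ≤ u := hk.trans hkR
  have h1 : 0 ≤ 4 * h * z * u * (w - k) := by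
    have : 0 ≤ w - k := by linarith
    positivity
  have h2 : h * z ^ 2 * (u * (u - k)) ≤ H * (u ^ 2 - k ^ 2) := by
    have ha : h * z ^ 2 ≤ H := (mul_le_of_le_one_right h0 (pow_le_one₀ hz0 hz1)).trans hH
    have hb : u * (u - k) ≤ u ^ 2 - k ^ 2 := by nlinarith
    have hc : 0 ≤ u * (u - k) := mul_nonneg hu (by linarith)
    exact mul_le_mul ha hb hc (by linarith)
  nlinarith

section Disk

variable {ρ : ℝ} {g : ℝ → ℝ}

theorem mem_disk_le {ρ : ℝ} (Q : disk ρ) : geodDist 1 (Q : SO3) ≤ ρ := le_of_lt Q.2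

theorem continuous_hFun_geodDist (h0 : 0 ≤ ρ) (hπ : ρ < Real.pi / 2)
    (hg : ContinuousOn (dg g) (Ici 0)) {R : SO3} (hR : geodDist 1 R ≤ ρ) :
    Continuous fun Q : disk ρ => hFun g (geodDist R Q) := by
  have hc : Continuous fun Q : disk ρ => geodDist R Q :=
    continuous_geodDist continuous_const continuous_subtype_val
  refine (continuousOn_hFun hg).comp_continuous hc fun Q => ?_
  exact ⟨geodDist_nonneg _ _, by linarith [geodDist_le_two_mul h0 hπ hR (mem_disk_le Q)]⟩

theorem integrable_hFun_mul (h0 : 0 ≤ ρ) (hπ : ρ < Real.pi / 2)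
    (hg : ContinuousOn (dg g) (Ici 0)) (hg0 : ∀ s, 0 ≤ s → 0 ≤ dg g s) {R : SO3}
    (hR : geodDist 1 R ≤ ρ) (μ : Measure (disk ρ)) [IsFiniteMeasure μ] {F : SO3 → ℝ}
    (hF : Continuous F) :
    Integrable (fun Q : disk ρ => hFun g (geodDist R Q) * F Q) μ := by
  obtain ⟨H, hH0, hH⟩ := exists_hFun_le hg hπ
  obtain ⟨B, hB⟩ := (isCompact_univ (X := SO3)).exists_bound_of_continuousOn hF.continuousOn
  refine Integrable.of_bound (C := H * B) ((continuous_hFun_geodDist h0 hπ hg hR).mul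
    (hF.comp continuous_subtype_val)).aestronglyMeasurable (Filter.Eventually.of_forall fun Q => ?_)
  have hle := geodDist_le_two_mul h0 hπ hR (mem_disk_le Q)
  have hn := geodDist_nonneg R Q
  rw [norm_mul, Real.norm_of_nonneg (hFun_nonneg hg0 hn (by linarith))]
  exact mul_le_mul (hH _ ⟨hn, hle⟩) (hB _ (mem_univ _)) (norm_nonneg _) hH0.le

theorem integrable_pull (h0 : 0 ≤ ρ) (hπ : ρ < Real.pi / 2)
    (hg : ContinuousOn (dg g) (Ici 0)) (hg0 : ∀ s, 0 ≤ s → 0 ≤ dg g s) (A : SO3) {R : SO3}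
    (hR : geodDist 1 R ≤ ρ) (μ : Measure (disk ρ)) [IsFiniteMeasure μ] :
    Integrable (fun Q : disk ρ => pull g A R Q) μ := by
  unfold pull
  have := continuous_toward R
  exact (integrable_hFun_mul h0 hπ hg hg0 hR μ (F := fun Q =>
    ((A : Matrix (Fin 3) (Fin 3) ℝ).transpose * toward R Q).trace) (by fun_prop)).div_const 4

theorem velocity_apply (h0 : 0 ≤ ρ) (hπ : ρ < Real.pi / 2) (hgd : DifferentiableOn ℝ g (Ici 0))
    {R : SO3} (hR : geodDist 1 R ≤ ρ) (μ : Measure (disk ρ)) (i j : Fin 3) :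
    velocity g μ R i j = ∫ Q : disk ρ, hFun g (geodDist R Q) * toward R Q i j ∂μ := by
  rw [velocity, Matrix.of_apply, ← integral_neg]
  congr 1
  funext Q
  rw [grad_potential hgd R Q (by linarith [geodDist_le_two_mul h0 hπ hR (mem_disk_le Q)])]
  simp

theorem trace_transpose_mul_velocity (h0 : 0 ≤ ρ) (hπ : ρ < Real.pi / 2)
    (hgd : DifferentiableOn ℝ g (Ici 0)) (hg : ContinuousOn (dg g) (Ici 0))
    (hg0 : ∀ s, 0 ≤ s → 0 ≤ dg g s) (A : SO3) {R : SO3}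
    (hR : geodDist 1 R ≤ ρ) (μ : Measure (disk ρ)) [IsFiniteMeasure μ] :
    (∑ i, ∑ j, (A : Matrix (Fin 3) (Fin 3) ℝ) i j * velocity g μ R i j) / 4 =
      ∫ Q : disk ρ, pull g A R Q ∂μ := by
  have hint : ∀ i j, Integrable (fun Q : disk ρ => (A : Matrix (Fin 3) (Fin 3) ℝ) i j *
      (hFun g (geodDist R Q) * toward R Q i j)) μ := fun i j => by
    have := continuous_toward R
    exact (integrable_hFun_mul h0 hπ hg hg0 hR μ (F := fun Q => toward R Q i j)
      (by fun_prop)).const_mul _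
  simp only [velocity_apply h0 hπ hgd hR, ← integral_const_mul]
  rw [Finset.sum_congr rfl fun i _ => (integral_finsetSum _ fun j _ => hint i j).symm,
    ← integral_finsetSum _ fun i _ => integrable_finsetSum _ fun j _ => hint i j,
    ← integral_div]
  congr 1
  funext Q
  rw [pull, Matrix.trace]
  simp only [Matrix.diag_apply, Matrix.mul_apply, Matrix.transpose_apply, Fin.sum_univ_three]
  ring

theorem hasDerivWithinAt_cosSq {X Y : ℝ → SO3} {V W : Matrix (Fin 3) (Fin 3) ℝ} {s : Set ℝ} {t : ℝ}
    (hX : ∀ i j, HasDerivWithinAt (fun τ => (X τ : Matrix (Fin 3) (Fin 3) ℝ) i j) (V i j) s t)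
    (hY : ∀ i j, HasDerivWithinAt (fun τ => (Y τ : Matrix (Fin 3) (Fin 3) ℝ) i j) (W i j) s t) :
    HasDerivWithinAt (fun τ => cosSq (X τ) (Y τ))
      ((∑ i, ∑ j, (Y t : Matrix (Fin 3) (Fin 3) ℝ) i j * V i j) / 4 +
        (∑ i, ∑ j, (X t : Matrix (Fin 3) (Fin 3) ℝ) i j * W i j) / 4) s t := by
  have heq : (fun τ => cosSq (X τ) (Y τ)) = fun τ => (1 + ∑ i, ∑ j,
      (X τ : Matrix (Fin 3) (Fin 3) ℝ) i j * (Y τ : Matrix (Fin 3) (Fin 3) ℝ) i j) / 4 := by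
    funext τ
    rw [cosSq, Matrix.trace, Finset.sum_comm]
    simp only [Matrix.diag_apply, Matrix.mul_apply, Matrix.transpose_apply]
  rw [heq]
  have h := ((HasDerivWithinAt.fun_sum (u := Finset.univ) fun i _ =>
    HasDerivWithinAt.fun_sum (u := Finset.univ) fun j _ =>
      (hX i j).mul (hY i j)).const_add (1 : ℝ)).div_const 4
  refine h.congr_deriv ?_
  rw [← add_div, ← Finset.sum_add_distrib]
  congr 1
  refine Finset.sum_congr rfl fun i _ => ?_
  rw [← Finset.sum_add_distrib]
  exact Finset.sum_congr rfl fun j _ => by ring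

end Disk

/-! ### Confinement and contraction of the particles -/

section Particles

variable {ρ : ℝ} {g : ℝ → ℝ} {ι : Type*} {X : ι → ℝ → SO3} {μ : ℝ → Measure (disk ρ)}

theorem le_integral_of_ae_le {α : Type*} [MeasurableSpace α] {ν : Measure α}
    [IsProbabilityMeasure ν] {F : α → ℝ} {c : ℝ} (hF : Integrable F ν) (h : ∀ᵐ x ∂ν, c ≤ F x) :
    c ≤ ∫ x, F x ∂ν := by
  simpa using integral_mono_ae (integrable_const c) hF h

/-- Geodesic disks around points of the domain that contain all particles at some time contain
them at all later times. -/
theorem le_cosSq_of_le_cosSq [∀ t, IsProbabilityMeasure (μ t)] (h0 : 0 ≤ ρ) (hπ : ρ < Real.pi / 2)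
    (hgd : DifferentiableOn ℝ g (Ici 0)) (hg : ContinuousOn (dg g) (Ici 0))
    (hg0 : ∀ s, 0 ≤ s → 0 ≤ dg g s) (hXU : ∀ i t, 0 ≤ t → geodDist 1 (X i t) ≤ ρ)
    (hX : ∀ i t, 0 ≤ t → ∀ k l, HasDerivWithinAt
      (fun s => (X i s : Matrix (Fin 3) (Fin 3) ℝ) k l) (velocity g (μ t) (X i t) k l) (Ici 0) t)
    (hae : ∀ t, 0 ≤ t → ∀ K : Set SO3, IsClosed K → (∀ i, X i t ∈ K) → ∀ᵐ Q : disk ρ ∂μ t, (Q : SO3) ∈ K)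
    {A : SO3} (hA : geodDist 1 A ≤ ρ) {s t m : ℝ} (hs : 0 ≤ s) (hst : s ≤ t)
    (hm : ∀ i, m ≤ cosSq A (X i s)) (i : ι) : m ≤ cosSq A (X i t) := by
  obtain ⟨H, hH0, hH⟩ := exists_hFun_le hg hπ
  refine lower_bound_persists (f := fun i t => cosSq A (X i t))
    (f' := fun i t => ∫ Q : disk ρ, pull g A (X i t) Q ∂μ t) (C := 4 * H) (b := 0)
    (by positivity) hs hst (fun j τ hτ => cosSq_nonneg (hA.trans hπ.le) ((hXU j τ hτ).trans hπ.le))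
    ?_ ?_ hm i
  · intro j τ hτ
    have hA' : ∀ k l, HasDerivWithinAt (fun _ : ℝ => (A : Matrix (Fin 3) (Fin 3) ℝ) k l)
        ((0 : Matrix (Fin 3) (Fin 3) ℝ) k l) (Ici 0) τ := fun k l => hasDerivWithinAt_const _ _ _
    have h := hasDerivWithinAt_cosSq (Y := fun _ => A) (hX j τ hτ) hA'
    simp only [cosSq_comm _ A] at h
    refine h.congr_deriv ?_
    rw [trace_transpose_mul_velocity h0 hπ hgd hg hg0 A (hXU j τ hτ)]
    simp
  · intro τ hτ m hm0 hmj j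
    refine le_integral_of_ae_le (integrable_pull h0 hπ hg hg0 A (hXU j τ hτ) (μ τ)) ?_
    have hcl : IsClosed {Q : SO3 | m ≤ cosSq A Q} :=
      isClosed_le continuous_const (continuous_cosSq continuous_const continuous_id)
    filter_upwards [hae τ hτ _ hcl hmj] with Q hQ
    have hAl := hA.trans hπ.le
    have hRl := (hXU j τ hτ).trans hπ.le
    have hQl := (mem_disk_le Q).trans hπ.le
    have hn := geodDist_nonneg (X j τ) Q
    have hle := geodDist_le_two_mul h0 hπ (hXU j τ hτ) (mem_disk_le Q)
    have hh0 := hFun_nonneg hg0 hn (by linarith)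
    have h := pull_ge (g := g) hAl hRl hQl hh0 (hH _ ⟨hn, hle⟩) (Real.sqrt_nonneg m)
      (Real.sqrt_le_sqrt (hmj j)) (Real.sqrt_le_sqrt hQ)
    rw [Real.sq_sqrt hm0] at h
    -- Confinement only needs the gain to be non-negative.
    have hnn : 0 ≤ 4 * halfCos A (X j τ) * √m * (hFun g (geodDist (X j τ) Q) *
        (halfCos (X j τ) Q * (1 - halfCos (X j τ) Q))) := by
      have h1 := halfCos_nonneg A (X j τ)
      have h2 := halfCos_nonneg (X j τ) Q
      have h3 : 0 ≤ 1 - halfCos (X j τ) Q := by linarith [halfCos_le_one (X j τ) Q]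
      positivity
    linarith

/-- If `z = cos (d / 2)` stays away from `1`, then the interaction is bounded below. -/
theorem le_hFun_mul_of_halfCos_le {r β η b : ℝ} (hr : 0 ≤ r) (hrπ : r < Real.pi / 4)
    (hmono : MonotoneOn (hFun g) (Icc 0 (2 * r))) (hb0 : 0 ≤ b) (hb : b ≤ Real.arccos (1 - η / 8))
    (hbr : b ≤ 2 * r) (hβ : hFun g b = β) (hβ0 : 0 ≤ β) {R Q : SO3}
    (hz2 : halfCos R Q ^ 2 = cosSq R Q) (hz : Real.cos r ^ 2 ≤ cosSq R Q) (hη : 0 ≤ η)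
    (hzη : η / 16 ≤ 1 - halfCos R Q) :
    β * η / 32 ≤ hFun g (geodDist R Q) * (halfCos R Q * (1 - halfCos R Q)) := by
  have hz0 := halfCos_nonneg R Q
  have hz1 := halfCos_le_one R Q
  have hcos : 1 / 2 ≤ Real.cos r ^ 2 := by
    rw [Real.cos_sq]
    have : 0 ≤ Real.cos (2 * r) :=
      Real.cos_nonneg_of_neg_pi_div_two_le_of_le (by linarith) (by linarith)
    linarith
  have hzh : 1 / 2 ≤ halfCos R Q := by nlinarith
  have hle : geodDist R Q ≤ 2 * r := by
    rw [geodDist_le_iff (by linarith) (by linarith), mul_div_cancel_left₀ _ two_ne_zero]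
    exact hz
  have hge : b ≤ geodDist R Q := by
    refine hb.trans ?_
    rw [geodDist_eq_arccos_cosSq]
    -- z ≤ 1 - η/16 gives 2z² - 1 ≤ 2z - 1 ≤ 1 - η/8.
    exact Real.arccos_le_arccos (by nlinarith)
  have hh : β ≤ hFun g (geodDist R Q) :=
    hβ ▸ hmono ⟨hb0, hbr⟩ ⟨hb0.trans hge, hle⟩ hge
  have hprod : η / 32 ≤ halfCos R Q * (1 - halfCos R Q) := by nlinarith
  calc β * η / 32 = β * (η / 32) := by ring
    _ ≤ _ := mul_le_mul hh hprod (by linarith) (hβ0.trans hh)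

/-- All particles eventually come arbitrarily close to each other. -/
theorem eventually_one_sub_le_cosSq [∀ t, IsProbabilityMeasure (μ t)] (h0 : 0 ≤ ρ)
    (hπ : ρ < Real.pi / 2) {r : ℝ} (hr : 0 < r) (hrπ : r < Real.pi / 4)
    (hgd : DifferentiableOn ℝ g (Ici 0)) (hg : ContinuousOn (dg g) (Ici 0))
    (hg0 : ∀ s, 0 ≤ s → 0 ≤ dg g s) (hmono : MonotoneOn (hFun g) (Icc 0 (2 * r)))
    (hpos : ∀ a : ℝ, 0 < a → ∃ b : ℝ, 0 < b ∧ b < a ∧ 0 < hFun g b)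
    (hXU : ∀ i t, 0 ≤ t → geodDist 1 (X i t) ≤ ρ)
    (hX : ∀ i t, 0 ≤ t → ∀ k l, HasDerivWithinAt
      (fun s => (X i s : Matrix (Fin 3) (Fin 3) ℝ) k l) (velocity g (μ t) (X i t) k l) (Ici 0) t)
    (hae : ∀ t, 0 ≤ t → ∀ K : Set SO3, IsClosed K → (∀ i, X i t ∈ K) → ∀ᵐ Q : disk ρ ∂μ t, (Q : SO3) ∈ K)
    (hXr : ∀ i t, 0 ≤ t → geodDist 1 (X i t) ≤ r) {η : ℝ} (hη : 0 < η) :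
    ∃ T, 0 ≤ T ∧ ∀ t, T ≤ t → ∀ i j, 1 - η ≤ cosSq (X i t) (X j t) := by
  obtain ⟨H, hH0, hH⟩ := exists_hFun_le hg hπ
  have hπ4 := Real.pi_pos
  have hcos0 : 0 ≤ Real.cos r := Real.cos_nonneg_of_neg_pi_div_two_le_of_le (by linarith) (by linarith)
  have hcos : 1 / 2 ≤ Real.cos r ^ 2 := by
    rw [Real.cos_sq]
    have : 0 ≤ Real.cos (2 * r) :=
      Real.cos_nonneg_of_neg_pi_div_two_le_of_le (by linarith) (by linarith)
    linarith
  have hXl := fun i τ hτ => (hXU i τ hτ).trans hπ.le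
  have hbelow : ∀ i j τ, 0 ≤ τ → Real.cos r ^ 2 ≤ cosSq (X i τ) (X j τ) := fun i j τ hτ => by
    rw [← halfCos_sq (hXl i τ hτ) (hXl j τ hτ)]
    exact pow_le_pow_left₀ hcos0
      (cos_le_halfCos hr.le (by linarith) (hXr i τ hτ) (hXr j τ hτ)) 2
  -- Both points of a pair move, so both pulls contribute.
  set F : SO3 → SO3 → SO3 → ℝ := fun R S Q => pull g S R Q + pull g R S Q with hF
  have hbase : ∀ τ, 0 ≤ τ → ∀ m, Real.cos r ^ 2 ≤ m → (∀ p : ι × ι, m ≤ cosSq (X p.1 τ) (X p.2 τ)) →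
      ∀ i j, ∀ᵐ Q : disk ρ ∂μ τ, m ≤ cosSq (X i τ) Q ∧ m ≤ cosSq (X j τ) Q ∧
        -(8 * H) * (cosSq (X i τ) (X j τ) - m) +
        2 * (hFun g (geodDist (X i τ) Q) * (halfCos (X i τ) Q * (1 - halfCos (X i τ) Q)) +
          hFun g (geodDist (X j τ) Q) * (halfCos (X j τ) Q * (1 - halfCos (X j τ) Q))) ≤
        F (X i τ) (X j τ) Q ∧
        0 ≤ hFun g (geodDist (X i τ) Q) * (halfCos (X i τ) Q * (1 - halfCos (X i τ) Q)) ∧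
        0 ≤ hFun g (geodDist (X j τ) Q) * (halfCos (X j τ) Q * (1 - halfCos (X j τ) Q)) := by
    intro τ hτ m hbm hm i j
    have hcl : ∀ A, IsClosed {Q : SO3 | m ≤ cosSq A Q} := fun A =>
      isClosed_le continuous_const (continuous_cosSq continuous_const continuous_id)
    filter_upwards [hae τ hτ _ (hcl (X i τ)) fun j => hm (i, j),
      hae τ hτ _ (hcl (X j τ)) fun i => hm (j, i)] with Q hQi hQj
    have hQl := (mem_disk_le Q).trans hπ.le
    have hm0 : 0 ≤ m := by linarith
    have hni := geodDist_nonneg (X i τ) Q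
    have hnj := geodDist_nonneg (X j τ) Q
    have hlei := geodDist_le_two_mul h0 hπ (hXU i τ hτ) (mem_disk_le Q)
    have hlej := geodDist_le_two_mul h0 hπ (hXU j τ hτ) (mem_disk_le Q)
    have hhi := hFun_nonneg hg0 hni (by linarith)
    have hhj := hFun_nonneg hg0 hnj (by linarith)
    have h1 := pull_ge (g := g) (hXl j τ hτ) (hXl i τ hτ) hQl hhi (hH _ ⟨hni, hlei⟩)
      (Real.sqrt_nonneg m) (Real.sqrt_le_sqrt (hm (j, i))) (Real.sqrt_le_sqrt hQj)
    have h2 := pull_ge (g := g) (hXl i τ hτ) (hXl j τ hτ) hQl hhj (hH _ ⟨hnj, hlej⟩)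
      (Real.sqrt_nonneg m) (Real.sqrt_le_sqrt (hm (i, j))) (Real.sqrt_le_sqrt hQi)
    rw [Real.sq_sqrt hm0] at h1 h2
    rw [cosSq_comm (X j τ), halfCos_comm (X j τ) (X i τ)] at h1
    have hsm : √m ≤ halfCos (X i τ) (X j τ) := Real.sqrt_le_sqrt (hm (i, j))
    -- `halfCos` ≥ √m and m ≥ cos² r ≥ 1/2; here r < π/4 enters, and the factor 4 in the gain
    -- becomes 2.
    have hck : 1 / 2 ≤ halfCos (X i τ) (X j τ) * √m := by
      have := Real.mul_self_sqrt hm0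
      nlinarith [Real.sqrt_nonneg m]
    have hgi : 0 ≤ hFun g (geodDist (X i τ) Q) * (halfCos (X i τ) Q * (1 - halfCos (X i τ) Q)) :=
      mul_nonneg hhi (mul_nonneg (halfCos_nonneg _ _) (by linarith [halfCos_le_one (X i τ) Q]))
    have hgj : 0 ≤ hFun g (geodDist (X j τ) Q) * (halfCos (X j τ) Q * (1 - halfCos (X j τ) Q)) :=
      mul_nonneg hhj (mul_nonneg (halfCos_nonneg _ _) (by linarith [halfCos_le_one (X j τ) Q]))
    refine ⟨hQi, hQj, ?_, hgi, hgj⟩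
    have h3 := mul_le_mul_of_nonneg_right hck hgi
    have h4 := mul_le_mul_of_nonneg_right hck hgj
    simp only [hF]
    linarith
  have hint : ∀ i j τ, 0 ≤ τ → Integrable (fun Q : disk ρ => F (X i τ) (X j τ) Q) (μ τ) :=
    fun i j τ hτ => (integrable_pull h0 hπ hg hg0 _ (hXU i τ hτ) (μ τ)).add
      (integrable_pull h0 hπ hg hg0 _ (hXU j τ hτ) (μ τ))
  have hmain := eventually_one_sub_le (ι := ι × ι) (f := fun p t => cosSq (X p.1 t) (X p.2 t))
    (f' := fun p t => ∫ Q : disk ρ, F (X p.1 t) (X p.2 t) Q ∂μ t) (C := 8 * H)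
    (b := Real.cos r ^ 2) (by positivity) (fun p τ hτ => hbelow p.1 p.2 τ hτ) ?_ ?_ ?_ hη
  · obtain ⟨T, hT0, hT⟩ := hmain
    exact ⟨T, hT0, fun t ht i j => hT t ht (i, j)⟩
  · rintro ⟨i, j⟩ τ hτ
    refine (hasDerivWithinAt_cosSq (hX i τ hτ) (hX j τ hτ)).congr_deriv ?_
    rw [trace_transpose_mul_velocity h0 hπ hgd hg hg0 _ (hXU i τ hτ),
      trace_transpose_mul_velocity h0 hπ hgd hg hg0 _ (hXU j τ hτ), ← integral_add
      (integrable_pull h0 hπ hg hg0 _ (hXU i τ hτ) (μ τ))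
      (integrable_pull h0 hπ hg hg0 _ (hXU j τ hτ) (μ τ))]
  · rintro τ hτ m hbm hm ⟨i, j⟩
    refine le_integral_of_ae_le (hint i j τ hτ) ?_
    filter_upwards [hbase τ hτ m hbm hm i j] with Q hQ
    linarith [hQ.2.2.1, hQ.2.2.2.1, hQ.2.2.2.2]
  · intro η hη
    have hθ : 0 < Real.arccos (1 - η / 8) := Real.arccos_pos.2 (by linarith)
    obtain ⟨b, hb0, hb, hβ0⟩ := hpos (min (Real.arccos (1 - η / 8)) (2 * r))
      (lt_min hθ (by linarith))
    -- If the pair has `cosSq` at most 1 - η/2, one of its points has 1 - `halfCos` at least η/16 to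
    -- Q and the gain is h(b)η/16. Otherwise `cosSq` exceeds m by η/2, and the extra 1 in the rate
    -- supplies δ.
    refine ⟨8 * H + 1, by positivity, min (η / 2) (hFun g b * η / 16), by positivity, ?_⟩
    rintro τ hτ m hbm hmη hm ⟨i, j⟩
    refine le_integral_of_ae_le (hint i j τ hτ) ?_
    filter_upwards [hbase τ hτ m hbm hm i j] with Q ⟨hQi, hQj, hQ, hgi, hgj⟩
    have hcm : m ≤ cosSq (X i τ) (X j τ) := hm (i, j)
    have hmin1 := min_le_left (η / 2) (hFun g b * η / 16)
    have hmin2 := min_le_right (η / 2) (hFun g b * η / 16)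
    rcases le_total (cosSq (X i τ) (X j τ)) (1 - η / 2) with hc | hc
    · have hQl := (mem_disk_le Q).trans hπ.le
      have htri := one_sub_halfCos_le (hXl i τ hτ) hQl (hXl j τ hτ)
      have hc2 := halfCos_sq (hXl i τ hτ) (hXl j τ hτ)
      have hc1 : η / 4 ≤ 1 - halfCos (X i τ) (X j τ) := by
        nlinarith [sq_nonneg (1 - halfCos (X i τ) (X j τ))]
      have hgain : ∀ k, m ≤ cosSq (X k τ) Q → η / 16 ≤ 1 - halfCos (X k τ) Q →
          hFun g b * η / 32 ≤
            hFun g (geodDist (X k τ) Q) * (halfCos (X k τ) Q * (1 - halfCos (X k τ) Q)) :=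
        fun k hk hkη => le_hFun_mul_of_halfCos_le hr.le hrπ hmono hb0.le
          (hb.le.trans (min_le_left _ _)) (hb.le.trans (min_le_right _ _)) rfl hβ0.le
          (halfCos_sq (hXl k τ hτ) hQl) (hbm.trans hk) hη.le hkη
      rcases le_total (η / 16) (1 - halfCos (X i τ) Q) with hz | hz
      · linarith [hgain i hQi hz]
      · linarith [hgain j hQj (by linarith)]
    · linarith

end Particles

/-! ### Push-forwards, Wasserstein distance and concentration -/

instance : SecondCountableTopology SO3 :=
  haveI : SecondCountableTopology (Matrix (Fin 3) (Fin 3) ℝ) :=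
    inferInstanceAs (SecondCountableTopology (Fin 3 → Fin 3 → ℝ))
  TopologicalSpace.Subtype.secondCountableTopology
    (Matrix.specialOrthogonalGroup (Fin 3) ℝ : Set (Matrix (Fin 3) (Fin 3) ℝ))

theorem isClosed_closedDisk (r : ℝ) : IsClosed (closedDisk r) :=
  isClosed_le (continuous_geodDist continuous_const continuous_id) continuous_const

/-- A closed condition satisfied by all particles starting in the support of `ν` holds almost
surely for the push-forward of `ν`. -/
theorem ae_mem_of_eq_map {U : Set SO3} {μ ν : Measure U} [IsProbabilityMeasure μ] {f : U → U}
    (h : μ = ν.map f) {K : Set SO3} (hK : IsClosed K) (hf : ∀ R ∈ ν.support, (f R : SO3) ∈ K) :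
    ∀ᵐ Q : U ∂μ, (Q : SO3) ∈ K := by
  -- `Measure.map` is 0 for maps that are not a.e. measurable, so a non-zero image yields the
  -- measurability of f.
  have hne : ν.map f ≠ 0 := h ▸ IsProbabilityMeasure.ne_zero μ
  have hmeas : MeasurableSet {Q : U | (Q : SO3) ∈ K} :=
    (hK.preimage continuous_subtype_val).measurableSet
  rw [h, ae_map_iff (AEMeasurable.of_map_ne_zero hne) hmeas]
  filter_upwards [Measure.support_mem_ae (μ := ν)] with R hR using hf R hR

/-- If `μ` lives in the disk of radius `δ` around `P`, then `W₁(μ, δ_P) ≤ δ`. -/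
theorem W1_dirac_le {U : Set SO3} {μ : Measure U} [IsProbabilityMeasure μ] {P : U} {δ : ℝ}
    (h : ∀ᵐ Q : U ∂μ, geodDist Q P ≤ δ) : W1 μ (Measure.dirac P) ≤ ENNReal.ofReal δ := by
  have hm : Measurable fun Q : U => (Q, P) := measurable_id.prodMk measurable_const
  have hfst : (μ.map fun Q : U => (Q, P)).map Prod.fst = μ := by
    rw [Measure.map_map measurable_fst hm]
    exact Measure.map_id
  have hsnd : (μ.map fun Q : U => (Q, P)).map Prod.snd = Measure.dirac P := by
    rw [Measure.map_map measurable_snd hm]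
    change μ.map (fun _ => P) = _
    rw [Measure.map_const, measure_univ, one_smul]
  -- Test the infimum with the plan that sends all mass to P.
  refine (iInf₂_le (μ.map fun Q : U => (Q, P)) ⟨hfst, hsnd⟩).trans ?_
  refine (lintegral_map_le _ _).trans ?_
  calc ∫⁻ Q : U, ENNReal.ofReal (geodDist Q P) ∂μ ≤ ∫⁻ _ : U, ENNReal.ofReal δ ∂μ := by
        refine lintegral_mono_ae ?_
        filter_upwards [h] with Q hQ using ENNReal.ofReal_le_ofReal hQ
    _ = ENNReal.ofReal δ := by simp

/-- Concentration at a point for a global weak solution in the disk of radius `σ < π / 2` whose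
initial datum is supported in the closed disk of radius `r < min (σ, π / 4)`. -/
theorem exists_tendsto_W1_dirac {σ r : ℝ} (hr : 0 < r) (hrσ : r < σ) (hrπ : r < Real.pi / 4)
    (hσπ : σ < Real.pi / 2) {g : ℝ → ℝ} (hg_diff : DifferentiableOn ℝ g (Ici 0))
    (hgc : ContinuousOn (dg g) (Ici 0)) (hg_nonneg : ∀ s : ℝ, 0 ≤ s → 0 ≤ dg g s)
    (hh_pos : ∀ a : ℝ, 0 < a → ∃ b : ℝ, 0 < b ∧ b < a ∧ 0 < hFun g b)
    (hh_mono : MonotoneOn (hFun g) (Icc 0 (2 * r))) (ρ : ℝ → ProbabilityMeasure (disk σ))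
    (hρ₀ : ∀ R ∈ (ρ 0 : Measure (disk σ)).support, (R : SO3) ∈ closedDisk r)
    (hρ_sol : IsGlobalWeakSolution g ρ) :
    ∃ P : disk σ, (P : SO3) ∈ closedDisk r ∧
      Tendsto (fun t : ℝ => W1 (ρ t : Measure (disk σ)) (Measure.dirac P)) atTop (𝓝 0) := by
  obtain ⟨Ψ, hΨ, -, hmap⟩ := hρ_sol
  have hπ := Real.pi_pos
  have hσ0 : 0 ≤ σ := by linarith
  let S := (ρ 0 : Measure (disk σ)).support
  let X : S → ℝ → SO3 := fun R t => (Ψ t R : SO3)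
  let μ : ℝ → Measure (disk σ) := fun t => (ρ t : Measure (disk σ))
  have hXU : ∀ i t, 0 ≤ t → geodDist 1 (X i t) ≤ σ := fun i t _ => mem_disk_le (Ψ t i)
  have hX : ∀ i t, 0 ≤ t → ∀ k l, HasDerivWithinAt
      (fun s => (X i s : Matrix (Fin 3) (Fin 3) ℝ) k l) (velocity g (μ t) (X i t) k l) (Ici 0) t :=
    fun i t ht => (hΨ i i.2).2 t ht
  have hae : ∀ t, 0 ≤ t → ∀ K : Set SO3, IsClosed K → (∀ i, X i t ∈ K) →
      ∀ᵐ Q : disk σ ∂μ t, (Q : SO3) ∈ K :=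
    fun t ht K hK h => ae_mem_of_eq_map (hmap t ht) hK fun R hR => h ⟨R, hR⟩
  have hpersist : ∀ A : SO3, geodDist 1 A ≤ σ → ∀ s t m, 0 ≤ s → s ≤ t →
      (∀ i, m ≤ cosSq A (X i s)) → ∀ i, m ≤ cosSq A (X i t) := fun A hA s t m hs hst hm i =>
    le_cosSq_of_le_cosSq hσ0 hσπ hg_diff hgc hg_nonneg hXU hX hae hA hs hst hm i
  have h11 : geodDist 1 1 ≤ σ := by
    have : geodDist 1 1 = 0 := by norm_num [geodDist, Matrix.trace_one]
    rwa [this]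
  have hXr : ∀ i t, 0 ≤ t → geodDist 1 (X i t) ≤ r := fun i t ht => by
    rw [geodDist_le_iff hr.le (by linarith)]
    refine hpersist 1 h11 0 t _ le_rfl ht (fun j => ?_) i
    rw [← geodDist_le_iff hr.le (by linarith)]
    change geodDist 1 (Ψ 0 j : SO3) ≤ r
    rw [(hΨ j j.2).1]
    exact hρ₀ j j.2
  have hcontract := fun {η : ℝ} (hη : 0 < η) => eventually_one_sub_le_cosSq hσ0 hσπ hr hrπ hg_diff
    hgc hg_nonneg hh_mono hh_pos hXU hX hae hXr hη
  obtain ⟨i₀⟩ : Nonempty S :=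
    (Measure.nonempty_support (IsProbabilityMeasure.ne_zero (ρ 0 : Measure (disk σ)))).to_subtype
  obtain ⟨P, hPr, φ, hφ, hφP⟩ := (isClosed_closedDisk r).isCompact.tendsto_subseq
    (x := fun n : ℕ => X i₀ n) fun n => hXr i₀ n n.cast_nonneg
  -- A disk about `X i s` holding all particles at time s holds the later points of `X i₀`, hence
  -- their limit point P; convergence of that trajectory is not needed beforehand.
  have hPlim : ∀ s m, 0 ≤ s → (∀ i j, m ≤ cosSq (X i s) (X j s)) → ∀ i, m ≤ cosSq (X i s) P := by
    intro s m hs hm i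
    have hlim : Tendsto (fun n => cosSq (X i s) (X i₀ (φ n))) atTop (𝓝 (cosSq (X i s) P)) :=
      ((continuous_cosSq continuous_const continuous_id).tendsto P).comp hφP
    refine ge_of_tendsto hlim ?_
    filter_upwards [(tendsto_natCast_atTop_atTop.comp hφ.tendsto_atTop).eventually_ge_atTop s]
      with n hn
    exact hpersist (X i s) (hXU i s hs) s _ m hs hn (hm i) i₀
  refine ⟨⟨P, lt_of_le_of_lt hPr hrσ⟩, hPr, ?_⟩
  rw [ENNReal.tendsto_nhds_zero]
  intro e he
  obtain ⟨q, hq0, hqe⟩ := ENNReal.lt_iff_exists_nnreal_btwn.1 he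
  have hq0' : (0 : ℝ) < q := by exact_mod_cast hq0
  -- The cap 1 keeps δ < π, as `geodDist_le_iff` requires; the matching tolerance on `cosSq` is
  -- sin²(δ/2).
  set δ : ℝ := min q 1 with hδ
  have hδ0 : 0 < δ := lt_min hq0' one_pos
  have hδπ : δ < Real.pi := (min_le_right _ _).trans_lt (by linarith [Real.pi_gt_three])
  have hη : 0 < 1 - Real.cos (δ / 2) ^ 2 := by
    rw [← Real.sin_sq]
    exact pow_pos (Real.sin_pos_of_pos_of_lt_pi (by linarith) (by linarith)) 2
  obtain ⟨T, hT0, hT⟩ := hcontract hη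
  filter_upwards [eventually_ge_atTop T] with t ht
  have ht0 := hT0.trans ht
  refine (W1_dirac_le (δ := δ) ?_).trans ?_
  · refine hae t ht0 {Q | geodDist Q P ≤ δ}
      (isClosed_le (continuous_geodDist continuous_id continuous_const) continuous_const)
      fun i => ?_
    rw [mem_ofPred_eq, geodDist_le_iff hδ0.le hδπ]
    refine hPlim t _ ht0 (fun i j => ?_) i
    simpa using hT t ht i j
  · refine le_trans ?_ hqe.le
    rw [← ENNReal.ofReal_coe_nnreal]
    exact ENNReal.ofReal_le_ofReal (min_le_left _ _)

end SO3Aggregation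

end

theorem mainTheorem3
    (ε r : ℝ) (hε : 0 < ε) (hr : 0 < r) (hrε : r < Real.pi / 4 - ε)
    (g : ℝ → ℝ)
    (hg_diff : DifferentiableOn ℝ g (Set.Ici 0))
    (hg_lip : LocallyLipschitzOn (Set.Ici 0) (SO3Aggregation.dg g))
    (hg_nonneg : ∀ s : ℝ, 0 ≤ s → 0 ≤ SO3Aggregation.dg g s)
    (hg_C1 : ContDiffOn ℝ 1 (SO3Aggregation.dg g) (Set.Icc 0 (4 * r ^ 2)))
    (hh_pos : ∀ a : ℝ, 0 < a → ∃ b : ℝ, 0 < b ∧ b < a ∧ 0 < SO3Aggregation.hFun g b)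
    (hh_mono : MonotoneOn (SO3Aggregation.hFun g) (Set.Icc 0 (2 * r)))
    (ρ₀ : MeasureTheory.ProbabilityMeasure (SO3Aggregation.disk (Real.pi / 2 - ε)))
    (hρ₀ : ∀ R ∈ (ρ₀ : MeasureTheory.Measure (SO3Aggregation.disk (Real.pi / 2 - ε))).support,
      (R : SO3Aggregation.SO3) ∈ SO3Aggregation.closedDisk r)
    (ρ : ℝ → MeasureTheory.ProbabilityMeasure (SO3Aggregation.disk (Real.pi / 2 - ε)))
    (hρ_cont : ContinuousOn ρ (Set.Ici 0))
    (hρ_sol : SO3Aggregation.IsGlobalWeakSolution g ρ)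
    (hρ_init : ρ 0 = ρ₀) :
    ∃ P : SO3Aggregation.disk (Real.pi / 2 - ε),
      (P : SO3Aggregation.SO3) ∈ SO3Aggregation.closedDisk r ∧
      Filter.Tendsto
        (fun t : ℝ => SO3Aggregation.W1
          (ρ t : MeasureTheory.Measure (SO3Aggregation.disk (Real.pi / 2 - ε)))
          (MeasureTheory.Measure.dirac P))
        Filter.atTop (nhds 0) := by
  subst hρ_init
  exact SO3Aggregation.exists_tendsto_W1_dirac hr (by linarith) (by linarith) (by linarith)
    hg_diff hg_lip.continuousOn hg_nonneg hh_pos hh_mono ρ hρ₀ hρ_sol
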